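/- Conventions. A tt-category is an idempotent-complete triangulated category $\mathcal K$ (with suspension $\Sigma$) equipped with a symmetric monoidal structure $(\otimes,\mathbb 1)$ such that $\otimes$ is exact in each variable; the isomorphisms $X\otimes\Sigma Y\cong\Sigma(X\otimes Y)$ and $\Sigma X\otimes Y\cong\Sigma(X\otimes Y)$ are natural and compatible up to the usual sign $-1$ on $\Sigma X\otimes\Sigma Y$. A tt-functor is an exact strong symmetric monoidal functor. A tt-ring in $\mathcal K$ is a commutative associative unital ring object $(A,\mu,\eta)$ that is separable, i.e. $\mu:A\otimes A\to A$ has a section which is a morphism of $A,A$-bimodules. A splitting tower of $A$ is a sequence of tt-rings and ring homomorphisms $A^{[0]}\to A^{[1]}\to A^{[2]}\to\cdots$ with $A^{[0]}\cong\mathbb 1$ and $A^{[1]}\cong A$ such that for every $n\ge1$ there is an isomorphism of $A^{[n]}$-algebras $h:A^{[n]}\otimes_{A^{[n-1]}}A^{[n]}\xrightarrow{\ \sim\ }A^{[n]}\times A^{[n+1]}$ with $\mathrm{pr}_1h=\mu$ (the algebra structure on the source being through the left factor). We say that $A$ has finite degree $d\in\mathbb N$, written $\deg(A)=d$, if a splitting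 tower of $A$ exists and every splitting tower of $A$ satisfies $A^{[d]}\neq0$ and $A^{[d+1]}=0$ (a splitting tower is unique up to isomorphism). Theorem. Let $\mathcal K$ be a nonzero tt-category that admits a conservative tt-functor $F:\mathcal K\to\mathcal L$ into a tt-category $\mathcal L$ in which every object is isomorphic to a finite direct sum of suspensions $\Sigma^i\mathbb 1$, $i\in\mathbb Z$, of the unit. Then every tt-ring $A$ in $\mathcal K$ has finite degree. More precisely, if $F(A)\cong\bigoplus_{i=k}^{\ell}\Sigma^i\mathbb 1^{r_i}$ for integers $k,\ell$ and $r_k,\dots,r_\ell\in\mathbb N$, then $\deg(A)=\sum_{i=k}^{\ell}r_i$. -/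

import Mathlib

open CategoryTheory CategoryTheory.Limits CategoryTheory.MonoidalCategory

/-- A tensor-triangulated category (tt-category): a triangulated category with a symmetric
monoidal structure whose tensor product is exact in each variable, i.e. there are isomorphisms
`X ⊗ ΣY ≅ Σ(X ⊗ Y)` and `ΣX ⊗ Y ≅ Σ(X ⊗ Y)`, natural in both variables and compatible up to
the usual sign (`Functor.CommShift₂Int`), for which all functors `X ⊗ -` and `- ⊗ X` preserve
distinguished triangles. By convention tt-categories are idempotent complete. -/
class TTCategory (K : Type*) [Category* K] [Preadditive K] [HasZeroObject K] [HasShift K ℤ]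
    [∀ n : ℤ, (shiftFunctor K n).Additive] [Pretriangulated K]
    [MonoidalCategory K] [SymmetricCategory K] where
  isTriangulated : IsTriangulated K
  commShift : (curriedTensor K).CommShift₂Int
  exact_left (X : K) : ((curriedTensor K).obj X).IsTriangulated
  exact_right (X : K) : ((curriedTensor K).flip.obj X).IsTriangulated
  isIdempotentComplete : IsIdempotentComplete K

namespace TTRing

open scoped MonObj

/-- A ring object is separable if its multiplication `μ : A ⊗ A ⟶ A` has a section which is a
morphism of `A,A`-bimodules. -/
def IsSeparable {K : Type*} [Category* K] [MonoidalCategory K] (A : K) [MonObj A] : Prop :=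
  ∃ σ : A ⟶ A ⊗ A, σ ≫ μ[A] = 𝟙 A ∧
    μ[A] ≫ σ = A ◁ σ ≫ (α_ A A A).inv ≫ μ[A] ▷ A ∧
    μ[A] ≫ σ = σ ▷ A ≫ (α_ A A A).hom ≫ A ◁ μ[A]

end TTRing

/-- A tt-ring: a commutative separable ring object (a ring object being an associative unital
monoid for the tensor product). -/
structure TTRing (K : Type*) [Category* K] [MonoidalCategory K] [BraidedCategory K] where
  /-- The underlying object. -/
  X : K
  [mon : MonObj X]
  [comm : IsCommMonObj X]
  separable : TTRing.IsSeparable X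

namespace TTRing

open scoped MonObj

attribute [instance] TTRing.mon TTRing.comm

/-- The product ring object `A × B`: the object `A ⊕ B` with componentwise structure. -/
noncomputable instance prodMonObj {K : Type*} [Category* K] [HasZeroMorphisms K]
    [HasBinaryBiproducts K] [MonoidalCategory K] (A B : K) [MonObj A] [MonObj B] :
    MonObj (A ⊞ B) where
  one := biprod.lift η[A] η[B]
  mul := biprod.lift ((biprod.fst ⊗ₘ biprod.fst) ≫ μ[A]) ((biprod.snd ⊗ₘ biprod.snd) ≫ μ[B])
  one_mul := by
    ext
    · simp only [Category.assoc, biprod.lift_fst]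
      rw [whiskerRight_comp_tensorHom_assoc, biprod.lift_fst, MonObj.one_mul_hom]
    · simp only [Category.assoc, biprod.lift_snd]
      rw [whiskerRight_comp_tensorHom_assoc, biprod.lift_snd, MonObj.one_mul_hom]
  mul_one := by
    ext
    · simp only [Category.assoc, biprod.lift_fst]
      rw [whiskerLeft_comp_tensorHom_assoc, biprod.lift_fst, MonObj.mul_one_hom]
    · simp only [Category.assoc, biprod.lift_snd]
      rw [whiskerLeft_comp_tensorHom_assoc, biprod.lift_snd, MonObj.mul_one_hom]
  mul_assoc := by
    ext
    · simp only [Category.assoc, biprod.lift_fst]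
      rw [whiskerRight_comp_tensorHom_assoc, whiskerLeft_comp_tensorHom_assoc, biprod.lift_fst]
      simp only [MonoidalCategory.tensorHom_def, comp_whiskerRight, whiskerLeft_comp,
        Category.assoc, ← whisker_exchange_assoc, MonObj.mul_assoc]
      simp [whisker_exchange_assoc]
    · simp only [Category.assoc, biprod.lift_snd]
      rw [whiskerRight_comp_tensorHom_assoc, whiskerLeft_comp_tensorHom_assoc, biprod.lift_snd]
      simp only [MonoidalCategory.tensorHom_def, comp_whiskerRight, whiskerLeft_comp,
        Category.assoc, ← whisker_exchange_assoc, MonObj.mul_assoc]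
      simp [whisker_exchange_assoc]

/-- A tensor product `B ⊗_A C` of two algebras `f : A ⟶ B` and `g : A ⟶ C`: the coequalizer
`π : B ⊗ C ⟶ B ⊗_A C` of the two actions `(B ⊗ A) ⊗ C ⇉ B ⊗ C` of `A`, with the ring structure
for which `π` is a ring homomorphism. -/
structure RelTensor {K : Type*} [Category* K] [MonoidalCategory K] [BraidedCategory K]
    {A B C : K} [MonObj A] [MonObj B] [MonObj C] (f : A ⟶ B) (g : A ⟶ C) where
  /-- The object `B ⊗_A C`. -/
  X : K
  [mon : MonObj X]
  /-- The canonical epimorphism. -/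
  π : B ⊗ C ⟶ X
  [isMonHom_π : IsMonHom π]
  w : ((B ◁ f ≫ μ[B]) ▷ C) ≫ π = ((α_ B A C).hom ≫ B ◁ (g ▷ C ≫ μ[C])) ≫ π
  /-- `π` is the coequalizer of the two actions. -/
  isColimit : IsColimit (Cofork.ofπ π w)

attribute [instance] RelTensor.mon RelTensor.isMonHom_π

/-- For ring homomorphisms `f : A ⟶ B` and `g : B ⟶ C`, the `B`-algebra `C` is the complement
of `B` in `B ⊗_A B`: there is an isomorphism of `B`-algebras `h : B ⊗_A B ≅ B × C` with
`pr₁ h = μ`, where `B` acts on `B ⊗_A B` through the left factor, i.e. through the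
homomorphism "`b ↦ b ⊗ 1`". -/
def IsSplitting {K : Type*} [Category* K] [HasZeroMorphisms K] [HasBinaryBiproducts K]
    [MonoidalCategory K] [BraidedCategory K] {A B C : K} [MonObj A] [MonObj B] [MonObj C]
    (f : A ⟶ B) (g : B ⟶ C) : Prop :=
  ∃ (P : RelTensor f f) (h : P.X ≅ B ⊞ C), IsMonHom h.hom ∧
    P.π ≫ h.hom ≫ biprod.fst = μ[B] ∧
    ((ρ_ B).inv ≫ B ◁ η[B] ≫ P.π) ≫ h.hom = biprod.lift (𝟙 B) g

/-- A splitting tower `A^(0) ⟶ A^(1) ⟶ A^(2) ⟶ ⋯` of a tt-ring `A`: a sequence of tt-rings and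
ring homomorphisms with `A^(0) ≅ 𝟙`, `A^(1) ≅ A` and, for all `n ≥ 1`, an isomorphism of
`A^(n)`-algebras `h : A^(n) ⊗_{A^(n-1)} A^(n) ≅ A^(n) × A^(n+1)` such that `pr₁ h = μ`. -/
structure SplittingTower {K : Type*} [Category* K] [HasZeroMorphisms K] [HasBinaryBiproducts K]
    [MonoidalCategory K] [BraidedCategory K] (A : TTRing K) where
  /-- The tt-ring `A^(n)`. -/
  obj (n : ℕ) : TTRing K
  /-- The transition homomorphism `A^(n) ⟶ A^(n+1)`. -/
  map (n : ℕ) : (obj n).X ⟶ (obj (n + 1)).X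
  isMonHom_map (n : ℕ) : IsMonHom (map n)
  /-- `A^(0)` is the unit. -/
  isoZero : (obj 0).X ≅ 𝟙_ K
  isMonHom_isoZero : IsMonHom isoZero.hom
  /-- `A^(1)` is `A`. -/
  isoOne : (obj 1).X ≅ A.X
  isMonHom_isoOne : IsMonHom isoOne.hom
  splitting (n : ℕ) : IsSplitting (map n) (map (n + 1))

/-- `A` has finite degree `d`: `A^(d) ≠ 0` and `A^(d+1) = 0`. As the tower is only defined up
to isomorphism, this asks that a splitting tower exists and that the condition holds for
each one. -/
structure HasDegree {K : Type*} [Category* K] [HasZeroMorphisms K] [HasBinaryBiproducts K]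
    [MonoidalCategory K] [BraidedCategory K] (A : TTRing K) (d : ℕ) : Prop where
  exists_tower : Nonempty (SplittingTower A)
  not_isZero (T : SplittingTower A) : ¬ IsZero (T.obj d).X
  isZero (T : SplittingTower A) : IsZero (T.obj (d + 1)).X

end TTRing

/-! The degree is found by counting ranks. In a splitting tower, `A^(n) ⊗ A` is the sum of `n`
copies of `A^(n)` and one copy of `A^(n+1)`: over `A^(n)` the algebra `A` has acquired `n` trivial
factors, and `A^(n+1)` is what remains. Apply `F`. In `L` every object is a sum of suspensions of
the unit; the number of summands is well defined, additive for `⊞` and multiplicative for `⊗`. If `F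
A` has rank `d`, then `F A^(n)` has rank `d(d-1)⋯(d-n+1)`. This is `d! ≠ 0` for `n = d` and `0` for
`n = d + 1`, and conservativity of `F` brings the vanishing back to `K`.

Three results carry this. Towers exist (`exists_splitting`) because separability realizes `B ⊗_A B`,
and the complement of `B` in it, as images of idempotents of `B ⊗ B`. The formula for `A^(n) ⊗ A`
(`SplittingTower.exists_decomposition`, `IsDecomposition.nonempty_iso`) is proved in `K` by a Yoneda
argument: `Hom(A, N)` is described for all `A^(n)`-modules `N`, so that passing to `A^(n+1)` is mere
restriction of modules. Invariance of rank (`SumDecomposition.card_eq`) holds because suspensions of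
the unit are invertible: their endomorphisms are scalars, which can be reduced to a residue field of
`End 𝟙`. Suspensions in different degrees may be isomorphic, so only the total number of summands is
compared. -/

namespace TTRing

open scoped MonObj

/-! ### Ring structures and separability on retracts, images and tensor products. -/

section Multiplier

variable {C : Type*} [Category* C] [MonoidalCategory C]

/-- An endomorphism of a ring object which is linear in both arguments of the multiplication. -/
structure IsMultiplier {D : C} [MonObj D] (p : D ⟶ D) : Prop where
  left : p ▷ D ≫ μ = μ ≫ p
  right : D ◁ p ≫ μ = μ ≫ p

variable {D E : C} [MonObj D]

/-- The ring structure on a retract of a ring object whose idempotent is a multiplier. -/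
@[reducible]
def retractMonObj (r : D ⟶ E) (s : E ⟶ D) (hs : s ≫ r = 𝟙 E) (hp : IsMultiplier (r ≫ s)) :
    MonObj E where
  one := η[D] ≫ r
  mul := (s ⊗ₘ s) ≫ μ[D] ≫ r
  one_mul := by
    have h := hp.left
    have : (η[D] ≫ r) ▷ E ≫ (s ⊗ₘ s) ≫ μ[D] ≫ r =
        (𝟙_ C ◁ s ≫ η[D] ▷ D) ≫ ((r ≫ s) ▷ D ≫ μ) ≫ r := by
      simp only [← tensorHom_id, ← id_tensorHom, tensorHom_comp_tensorHom_assoc,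
        tensorHom_comp_tensorHom, Category.assoc, Category.id_comp, Category.comp_id]
    rw [this, h]
    simp [hs]
  mul_one := by
    have h := hp.right
    have : E ◁ (η[D] ≫ r) ≫ (s ⊗ₘ s) ≫ μ[D] ≫ r =
        (s ▷ 𝟙_ C ≫ D ◁ η[D]) ≫ (D ◁ (r ≫ s) ≫ μ) ≫ r := by
      simp only [← tensorHom_id, ← id_tensorHom, tensorHom_comp_tensorHom_assoc,
        tensorHom_comp_tensorHom, Category.assoc, Category.id_comp, Category.comp_id]
    rw [this, h]
    simp [hs]
  mul_assoc := by
    have h1 : ((s ⊗ₘ s) ≫ μ[D] ≫ r) ▷ E ≫ (s ⊗ₘ s) ≫ μ[D] ≫ r =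
        ((s ⊗ₘ s) ⊗ₘ s) ≫ μ ▷ D ≫ ((r ≫ s) ▷ D ≫ μ) ≫ r := by
      simp only [← tensorHom_id, tensorHom_comp_tensorHom_assoc,
        tensorHom_comp_tensorHom, Category.assoc, Category.id_comp, Category.comp_id]
    have h2 : E ◁ ((s ⊗ₘ s) ≫ μ[D] ≫ r) ≫ (s ⊗ₘ s) ≫ μ[D] ≫ r =
        (s ⊗ₘ (s ⊗ₘ s)) ≫ D ◁ μ ≫ (D ◁ (r ≫ s) ≫ μ) ≫ r := by
      simp only [← id_tensorHom, tensorHom_comp_tensorHom_assoc,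
        Category.assoc, Category.id_comp, Category.comp_id]
    rw [h1, h2, hp.left, hp.right]
    simp [hs]

lemma isMonHom_retract (r : D ⟶ E) (s : E ⟶ D) (hs : s ≫ r = 𝟙 E)
    (hp : IsMultiplier (r ≫ s)) :
    letI := retractMonObj r s hs hp
    IsMonHom r := by
  let := retractMonObj r s hs hp
  refine ⟨rfl, ?_⟩
  have : (r ⊗ₘ r) ≫ (s ⊗ₘ s) ≫ μ[D] ≫ r = D ◁ (r ≫ s) ≫ ((r ≫ s) ▷ D ≫ μ) ≫ r := by
    simp only [← tensorHom_id, ← id_tensorHom, tensorHom_comp_tensorHom_assoc,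
        Category.assoc, Category.id_comp, Category.comp_id]
  change _ = (r ⊗ₘ r) ≫ (s ⊗ₘ s) ≫ μ[D] ≫ r
  rw [this, hp.left, ← Category.assoc, ← Category.assoc, hp.right]
  simp [hs]

/-- Ring homomorphisms descend along split epimorphic ring homomorphisms. -/
lemma IsMonHom.of_splitEpi_comp {E G : C} [MonObj E] [MonObj G] (r : D ⟶ E) [IsMonHom r]
    (s : E ⟶ D) (hs : s ≫ r = 𝟙 E) (k : E ⟶ G) (h : IsMonHom (r ≫ k)) : IsMonHom k := by
  have h1 := h.one_hom
  have h2 := h.mul_hom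
  constructor
  · rw [← h1, IsMonHom.one_hom_assoc]
  · have hss : (s ⊗ₘ s) ≫ (r ⊗ₘ r) = 𝟙 _ := by simp [tensorHom_comp_tensorHom, hs]
    rw [← Category.id_comp μ, ← hss, Category.assoc, Category.assoc]
    rw [← IsMonHom.mul_hom_assoc, h2, ← tensorHom_comp_tensorHom, Category.assoc, reassoc_of% hss]

lemma IsCommMonObj.of_splitEpi [BraidedCategory C] [IsCommMonObj D] {E : C} [MonObj E]
    (r : D ⟶ E) [IsMonHom r] (s : E ⟶ D) (hs : s ≫ r = 𝟙 E) : IsCommMonObj E := by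
  refine ⟨?_⟩
  have hss : (s ⊗ₘ s) ≫ (r ⊗ₘ r) = 𝟙 _ := by simp [tensorHom_comp_tensorHom, hs]
  have : (r ⊗ₘ r) ≫ (β_ E E).hom ≫ μ = (r ⊗ₘ r) ≫ μ := by
    rw [BraidedCategory.braiding_naturality_assoc, ← IsMonHom.mul_hom,
      ← Category.assoc, IsCommMonObj.mul_comm]
  rw [← Category.id_comp ((β_ E E).hom ≫ μ[E]), ← hss, Category.assoc, this, reassoc_of% hss]

/-- Bilinearity gives `σ(a) = a σ(1)`, so `(r ⊗ r)(σ(a)) = r(a) · (r ⊗ r)(σ(1))` depends only on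
`r(a)`. The section therefore descends, although `s` need not be multiplicative. -/
lemma IsSeparable.of_splitEpi {E : C} [MonObj E] (r : D ⟶ E) [IsMonHom r] (s : E ⟶ D)
    (hs : s ≫ r = 𝟙 E) (h : IsSeparable D) : IsSeparable E := by
  obtain ⟨σ, h1, h2, h3⟩ := h
  have hss : (s ⊗ₘ s) ≫ (r ⊗ₘ r) = 𝟙 _ := by simp [tensorHom_comp_tensorHom, hs]
  have hσ : σ = (ρ_ D).inv ≫ D ◁ (η ≫ σ) ≫ (α_ D D D).inv ≫ μ ▷ D := by
    rw [whiskerLeft_comp, Category.assoc, ← h2]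
    simp
  have hr : r ≫ (ρ_ E).inv ≫ E ◁ (η[D] ≫ σ ≫ (r ⊗ₘ r)) ≫ (α_ E E E).inv ≫ μ ▷ E =
      σ ≫ (r ⊗ₘ r) := by
    conv_rhs => rw [hσ]
    rw [rightUnitor_inv_naturality_assoc]
    simp only [Category.assoc]
    congr 1
    have : μ[D] ▷ D ≫ (r ⊗ₘ r) = ((r ⊗ₘ r) ⊗ₘ r) ≫ μ ▷ E := by
      simp only [← tensorHom_id, tensorHom_comp_tensorHom, IsMonHom.mul_hom]
      simp
    rw [this, ← associator_inv_naturality_assoc]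
    simp only [← tensorHom_id, ← id_tensorHom, tensorHom_comp_tensorHom_assoc,
      Category.assoc, Category.id_comp, Category.comp_id]
  generalize (ρ_ E).inv ≫ E ◁ (η[D] ≫ σ ≫ (r ⊗ₘ r)) ≫ (α_ E E E).inv ≫ μ ▷ E = τ at hr
  have key : ∀ {Z : C} (u v : E ⊗ E ⟶ Z), (r ⊗ₘ r) ≫ u = (r ⊗ₘ r) ≫ v → u = v := by
    intro Z u v h
    rw [← Category.id_comp u, ← hss, Category.assoc, h, reassoc_of% hss]
  refine ⟨τ, ?_, key _ _ ?_, key _ _ ?_⟩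
  · rw [← Category.id_comp τ, ← hs, Category.assoc, Category.assoc, reassoc_of% hr,
      ← IsMonHom.mul_hom, reassoc_of% h1, hs]
  · rw [← IsMonHom.mul_hom_assoc, hr, reassoc_of% h2]
    have : (r ⊗ₘ r) ≫ E ◁ τ = D ◁ σ ≫ (r ⊗ₘ (r ⊗ₘ r)) := by
      simp only [← id_tensorHom, tensorHom_comp_tensorHom, Category.comp_id, Category.id_comp, hr]
    rw [reassoc_of% this, associator_inv_naturality_assoc]
    simp only [← tensorHom_id, tensorHom_comp_tensorHom, Category.comp_id, Category.id_comp,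
      IsMonHom.mul_hom]
  · rw [← IsMonHom.mul_hom_assoc, hr, reassoc_of% h3]
    have : (r ⊗ₘ r) ≫ τ ▷ E = σ ▷ D ≫ ((r ⊗ₘ r) ⊗ₘ r) := by
      simp only [← tensorHom_id, tensorHom_comp_tensorHom, Category.comp_id, Category.id_comp, hr]
    rw [reassoc_of% this, associator_naturality_assoc]
    simp only [← id_tensorHom, tensorHom_comp_tensorHom, Category.comp_id, Category.id_comp,
      IsMonHom.mul_hom]

open Functor.LaxMonoidal Functor.OplaxMonoidal in
lemma IsSeparable.map {C' : Type*} [Category* C'] [MonoidalCategory C'] (F : C ⥤ C') [F.Monoidal]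
    (h : IsSeparable D) :
    letI := F.monObjObj D
    IsSeparable (F.obj D) := by
  let := F.monObjObj D
  obtain ⟨σ, h1, h2, h3⟩ := h
  have hμ : μ[F.obj D] = Functor.LaxMonoidal.μ F D D ≫ F.map μ[D] := rfl
  refine ⟨F.map σ ≫ δ F D D, ?_, ?_, ?_⟩
  · rw [hμ]
    simp [← F.map_comp, h1]
  · rw [hμ]
    simp only [Category.assoc]
    rw [← F.map_comp_assoc, h2]
    rw [F.map_comp, F.map_comp, Functor.Monoidal.map_whiskerLeft,
      Functor.Monoidal.map_associator_inv, Functor.Monoidal.map_whiskerRight]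
    simp only [Category.assoc, Functor.Monoidal.μ_δ_assoc,
      Functor.Monoidal.μ_δ, Category.comp_id, whiskerLeft_comp, comp_whiskerRight]
  · rw [hμ]
    simp only [Category.assoc]
    rw [← F.map_comp_assoc, h3]
    rw [F.map_comp, F.map_comp, Functor.Monoidal.map_whiskerRight,
      Functor.Monoidal.map_associator, Functor.Monoidal.map_whiskerLeft]
    simp only [Category.assoc, Functor.Monoidal.μ_δ_assoc,
      Functor.Monoidal.μ_δ, Category.comp_id, whiskerLeft_comp, comp_whiskerRight]

/-- The tensor product is a monoidal functor `C × C ⥤ C`, and separability in `C × C` is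
componentwise. -/
lemma IsSeparable.tensor [BraidedCategory C] {E : C} [MonObj E] (hD : IsSeparable D)
    (hE : IsSeparable E) : IsSeparable (D ⊗ E) := by
  obtain ⟨σ, h1, h2, h3⟩ := hD
  obtain ⟨τ, k1, k2, k3⟩ := hE
  let : MonObj ((D, E) : C × C) :=
    { one := Prod.mkHom η[D] η[E]
      mul := Prod.mkHom μ[D] μ[E] }
  exact IsSeparable.map (MonoidalCategory.tensor C) (D := (D, E))
    ⟨Prod.mkHom σ τ, Prod.ext h1 k1, Prod.ext h2 k2, Prod.ext h3 k3⟩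

end Multiplier

/-! ### The separability idempotent and the relative tensor product. -/

section SeparabilityIdempotent

variable {C : Type*} [Category* C] [MonoidalCategory C] {A M N : C} [MonObj A]

/-- The map `m ⊗ a ⊗ n ↦ m σ(a)₁ ⊗ σ(a)₂ n` attached to a map `σ : A ⟶ A ⊗ A`, a right
action on `M` and a left action on `N`. -/
def sepMap (σ : A ⟶ A ⊗ A) (l : M ⊗ A ⟶ M) (r : A ⊗ N ⟶ N) : (M ⊗ A) ⊗ N ⟶ M ⊗ N :=
  (M ◁ σ ≫ (α_ M A A).inv) ▷ N ≫ (α_ (M ⊗ A) A N).hom ≫ (l ⊗ₘ r)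

/-- The endomorphism `m ⊗ n ↦ m σ(1)₁ ⊗ σ(1)₂ n`, which is an idempotent whose image is the
relative tensor product `M ⊗_A N` if `σ` is a separability section. -/
def sepIdem (σ : A ⟶ A ⊗ A) (l : M ⊗ A ⟶ M) (r : A ⊗ N ⟶ N) : M ⊗ N ⟶ M ⊗ N :=
  ((ρ_ M).inv ≫ M ◁ η[A]) ▷ N ≫ sepMap σ l r

variable {σ : A ⟶ A ⊗ A} {l : M ⊗ A ⟶ M} {r : A ⊗ N ⟶ N}

lemma sepIdem_eq_left : sepIdem σ l r =
    ((ρ_ M).inv ≫ M ◁ (η ≫ σ) ≫ (α_ M A A).inv ≫ l ▷ A) ▷ N ≫ (α_ M A N).hom ≫ M ◁ r := by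
  simp only [sepIdem, sepMap, MonoidalCategory.tensorHom_def]
  simp

lemma sepIdem_eq_right : sepIdem σ l r =
    M ◁ ((λ_ N).inv ≫ (η ≫ σ) ▷ N ≫ (α_ A A N).hom ≫ A ◁ r) ≫ (α_ M A N).inv ≫ l ▷ N := by
  simp only [sepIdem, sepMap, tensorHom_def']
  simp

lemma eq_mul_unit (h2 : μ[A] ≫ σ = A ◁ σ ≫ (α_ A A A).inv ≫ μ[A] ▷ A) :
    σ = (ρ_ A).inv ≫ A ◁ (η ≫ σ) ≫ (α_ A A A).inv ≫ μ ▷ A := by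
  rw [whiskerLeft_comp, Category.assoc, ← h2]
  simp

/-- Here `a σ(1) = σ(a)`; in `act_right_sepIdem`, `σ(1) a = σ(a)`. Both actions of `A` thus lead to
the same map `sepMap`, which says that `sepIdem` is balanced. -/
lemma act_left_sepIdem (hl : l ▷ A ≫ l = (α_ M A A).hom ≫ M ◁ μ ≫ l)
    (h2 : μ[A] ≫ σ = A ◁ σ ≫ (α_ A A A).inv ≫ μ[A] ▷ A) :
    l ▷ N ≫ sepIdem σ l r = sepMap σ l r := by
  have key : l ≫ (ρ_ M).inv ≫ M ◁ (η ≫ σ) ≫ (α_ M A A).inv ≫ l ▷ A =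
      M ◁ σ ≫ (α_ M A A).inv ≫ l ▷ A := by
    conv_rhs => rw [eq_mul_unit h2]
    rw [rightUnitor_inv_naturality_assoc, ← whisker_exchange_assoc,
      associator_inv_naturality_left_assoc, ← comp_whiskerRight, hl]
    simp
  have e2 : sepMap σ l r =
      (M ◁ σ ≫ (α_ M A A).inv ≫ l ▷ A) ▷ N ≫ (α_ M A N).hom ≫ M ◁ r := by
    simp only [sepMap, MonoidalCategory.tensorHom_def]
    simp
  rw [sepIdem_eq_left, e2, ← key]
  simp

lemma act_right_sepIdem (hr : A ◁ r ≫ r = (α_ A A N).inv ≫ μ ▷ N ≫ r)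
    (h3 : μ[A] ≫ σ = σ ▷ A ≫ (α_ A A A).hom ≫ A ◁ μ[A]) :
    (α_ M A N).hom ≫ M ◁ r ≫ sepIdem σ l r = sepMap σ l r := by
  have hσ : σ = (λ_ A).inv ≫ (η ≫ σ) ▷ A ≫ (α_ A A A).hom ≫ A ◁ μ := by
    rw [comp_whiskerRight, Category.assoc, ← h3]
    simp
  have key : r ≫ (λ_ N).inv ≫ (η ≫ σ) ▷ N ≫ (α_ A A N).hom ≫ A ◁ r =
      σ ▷ N ≫ (α_ A A N).hom ≫ A ◁ r := by
    conv_rhs => rw [hσ]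
    rw [leftUnitor_inv_naturality_assoc, whisker_exchange_assoc,
      associator_naturality_right_assoc, ← whiskerLeft_comp, hr]
    simp
  have e2 : sepMap σ l r = (α_ M A N).hom ≫
      M ◁ (σ ▷ N ≫ (α_ A A N).hom ≫ A ◁ r) ≫ (α_ M A N).inv ≫ l ▷ N := by
    simp only [sepMap, tensorHom_def']
    simp
  rw [sepIdem_eq_right, e2, ← key]
  simp

/-- A balanced `t` lets the second leg of `σ(a)` cross the tensor sign, where it meets the first leg
and `σ ≫ μ = 𝟙` applies. Hence balanced maps absorb `sepIdem`; being balanced itself, `sepIdem` is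
then idempotent and splits off the coequalizer. -/
lemma sepMap_comp (hl : l ▷ A ≫ l = (α_ M A A).hom ≫ M ◁ μ ≫ l) (h1 : σ ≫ μ = 𝟙 A)
    {Z : C} (t : M ⊗ N ⟶ Z) (ht : l ▷ N ≫ t = (α_ M A N).hom ≫ M ◁ r ≫ t) :
    sepMap σ l r ≫ t = l ▷ N ≫ t := by
  have h : M ◁ r ≫ t = (α_ M A N).inv ≫ l ▷ N ≫ t := by rw [ht]; simp
  simp only [sepMap, MonoidalCategory.tensorHom_def, Category.assoc, h]
  rw [associator_inv_naturality_left_assoc, ← comp_whiskerRight_assoc _ l, hl,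
    Iso.hom_inv_id_assoc, ← comp_whiskerRight_assoc, Category.assoc, Iso.inv_hom_id_assoc,
    ← whiskerLeft_comp_assoc, h1]
  simp

lemma sepIdem_comp (hl : l ▷ A ≫ l = (α_ M A A).hom ≫ M ◁ μ ≫ l) (h1 : σ ≫ μ = 𝟙 A)
    (hu : M ◁ η ≫ l = (ρ_ M).hom)
    {Z : C} (t : M ⊗ N ⟶ Z) (ht : l ▷ N ≫ t = (α_ M A N).hom ≫ M ◁ r ≫ t) :
    sepIdem σ l r ≫ t = t := by
  rw [sepIdem, Category.assoc, sepMap_comp hl h1 t ht, ← comp_whiskerRight_assoc, Category.assoc,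
    hu]
  simp

lemma sepIdem_self (h2 : μ[A] ≫ σ = A ◁ σ ≫ (α_ A A A).inv ≫ μ[A] ▷ A)
    (h3 : μ[A] ≫ σ = σ ▷ A ≫ (α_ A A A).hom ≫ A ◁ μ[A]) :
    sepIdem σ μ[A] μ[A] = μ ≫ σ := by
  rw [sepIdem_eq_left, ← eq_mul_unit h2, h3]

end SeparabilityIdempotent

/-! ### The actions of `A` on an `A`-algebra `B`, and bilinearity of the idempotent. -/

section Algebra

variable {C : Type*} [Category* C] [MonoidalCategory C] {A B : C} [MonObj B] (f : A ⟶ B)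

lemma mul_balanced :
    (B ◁ f ≫ μ) ▷ B ≫ μ = (α_ B A B).hom ≫ B ◁ (f ▷ B ≫ μ) ≫ μ := by
  simp

variable [MonObj A]

lemma right_act_assoc [IsMonHom f] :
    (B ◁ f ≫ μ) ▷ A ≫ B ◁ f ≫ μ = (α_ B A A).hom ≫ B ◁ μ ≫ B ◁ f ≫ μ := by
  rw [← whisker_exchange_assoc, comp_whiskerRight_assoc, MonObj.mul_assoc, ← whiskerLeft_comp_assoc,
    IsMonHom.mul_hom, tensorHom_def']
  simp only [Category.assoc, associator_naturality_right_assoc, associator_naturality_middle_assoc,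
    whiskerLeft_comp]

lemma left_act_assoc [IsMonHom f] :
    A ◁ (f ▷ B ≫ μ) ≫ f ▷ B ≫ μ = (α_ A A B).inv ≫ μ ▷ B ≫ f ▷ B ≫ μ := by
  rw [whisker_exchange_assoc, whiskerLeft_comp_assoc, MonObj.mul_assoc_flip,
    ← comp_whiskerRight_assoc, IsMonHom.mul_hom, MonoidalCategory.tensorHom_def]
  simp

lemma right_act_unit [IsMonHom f] : B ◁ η ≫ B ◁ f ≫ μ = (ρ_ B).hom := by
  rw [← whiskerLeft_comp_assoc, IsMonHom.one_hom, MonObj.mul_one]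

/-- The idempotent inserts `σ(1)` between the two factors, so it commutes with multiplication from
the outside. -/
lemma sepIdem_left_linear (σ : A ⟶ A ⊗ A) :
    B ◁ sepIdem σ (B ◁ f ≫ μ) (f ▷ B ≫ μ) ≫ (α_ B B B).inv ≫ μ ▷ B =
      (α_ B B B).inv ≫ μ ▷ B ≫ sepIdem σ (B ◁ f ≫ μ) (f ▷ B ≫ μ) := by
  have key : B ◁ ((ρ_ B).inv ≫ B ◁ (η ≫ σ) ≫ (α_ B A A).inv ≫ (B ◁ f ≫ μ) ▷ A) ≫
      (α_ B B A).inv ≫ μ ▷ A =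
      μ ≫ (ρ_ B).inv ≫ B ◁ (η ≫ σ) ≫ (α_ B A A).inv ≫ (B ◁ f ≫ μ) ▷ A := by
    rw [rightUnitor_inv_naturality_assoc, ← whisker_exchange_assoc,
      associator_inv_naturality_left_assoc, ← comp_whiskerRight, ← whisker_exchange_assoc,
      MonObj.mul_assoc]
    simp
  rw [sepIdem_eq_left]
  generalize (ρ_ B).inv ≫ B ◁ (η ≫ σ) ≫ (α_ B A A).inv ≫ (B ◁ f ≫ μ) ▷ A = u at key ⊢
  generalize f ▷ B ≫ μ = g
  rw [← comp_whiskerRight_assoc, ← key]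
  simp only [whiskerLeft_comp, Category.assoc]
  rw [associator_inv_naturality_right_assoc, whisker_exchange]
  simp

lemma sepIdem_right_linear (σ : A ⟶ A ⊗ A) :
    sepIdem σ (B ◁ f ≫ μ) (f ▷ B ≫ μ) ▷ B ≫ (α_ B B B).hom ≫ B ◁ μ =
      (α_ B B B).hom ≫ B ◁ μ ≫ sepIdem σ (B ◁ f ≫ μ) (f ▷ B ≫ μ) := by
  have key : ((λ_ B).inv ≫ (η ≫ σ) ▷ B ≫ (α_ A A B).hom ≫ A ◁ (f ▷ B ≫ μ)) ▷ B ≫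
      (α_ A B B).hom ≫ A ◁ μ =
      μ ≫ (λ_ B).inv ≫ (η ≫ σ) ▷ B ≫ (α_ A A B).hom ≫ A ◁ (f ▷ B ≫ μ) := by
    rw [leftUnitor_inv_naturality_assoc, whisker_exchange_assoc,
      associator_naturality_right_assoc, ← whiskerLeft_comp, whisker_exchange_assoc,
      MonObj.mul_assoc_flip]
    simp [-MonObj.mul_assoc]
  rw [sepIdem_eq_right]
  generalize (λ_ B).inv ≫ (η ≫ σ) ▷ B ≫ (α_ A A B).hom ≫ A ◁ (f ▷ B ≫ μ) = u at key ⊢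
  generalize B ◁ f ≫ μ = g
  rw [← whiskerLeft_comp_assoc, ← key]
  simp only [comp_whiskerRight, Category.assoc]
  rw [associator_naturality_left_assoc, ← whisker_exchange]
  simp

end Algebra

/-! ### Multipliers of a commutative ring object. -/

section Multiplier

/-- Both composites send `xy` to `p(x) q(y)`; now put `x = 1`. -/
lemma IsMultiplier.comm {C : Type*} [Category* C] [MonoidalCategory C] {D : C} [MonObj D]
    {p q : D ⟶ D} (hp : IsMultiplier p)
    (hq : IsMultiplier q) : p ≫ q = q ≫ p := by
  have h : μ[D] ≫ p ≫ q = μ[D] ≫ q ≫ p := by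
    rw [← reassoc_of% hp.left, ← hq.right, ← reassoc_of% hq.right, ← hp.left,
      whisker_exchange_assoc]
  simpa using (λ_ D).inv ≫= η[D] ▷ D ≫= h

variable {C : Type*} [Category* C] [MonoidalCategory C] [SymmetricCategory C]

/-- By commutativity, `(x ⊗ y)(z ⊗ w) = z · (x ⊗ y) · w`, so linearity over `B ⊗ B` amounts to
bilinearity over `B`. -/
lemma tensor_mul_eq {B : C} [MonObj B] [IsCommMonObj B] :
    μ[B ⊗ B] = (α_ (B ⊗ B) B B).inv ≫
      ((β_ (B ⊗ B) B).hom ≫ (α_ B B B).inv ≫ μ ▷ B) ▷ B ≫ (α_ B B B).hom ≫ B ◁ μ := by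
  rw [MonObj.tensorObj.mul_def, tensorμ, MonoidalCategory.tensorHom_def]
  simp only [Category.assoc, BraidedCategory.braiding_tensor_left_hom, Iso.hom_inv_id_assoc,
    ← comp_whiskerRight, IsCommMonObj.mul_comm]
  monoidal

lemma isMultiplier_of_bilinear {B : C} [MonObj B] [IsCommMonObj B] (φ : B ⊗ B ⟶ B ⊗ B)
    (h1 : B ◁ φ ≫ (α_ B B B).inv ≫ μ ▷ B = (α_ B B B).inv ≫ μ ▷ B ≫ φ)
    (h2 : φ ▷ B ≫ (α_ B B B).hom ≫ B ◁ μ = (α_ B B B).hom ≫ B ◁ μ ≫ φ) :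
    IsMultiplier φ := by
  have hl : φ ▷ (B ⊗ B) ≫ μ = μ ≫ φ := by
    rw [tensor_mul_eq, associator_inv_naturality_left_assoc, ← comp_whiskerRight_assoc,
      BraidedCategory.braiding_naturality_left_assoc, h1]
    simp only [comp_whiskerRight, Category.assoc, h2]
  refine ⟨hl, ?_⟩
  rw [← IsCommMonObj.mul_comm (B ⊗ B), BraidedCategory.braiding_naturality_right_assoc, hl,
    Category.assoc]

lemma isMultiplier_sepIdem {A B : C} [MonObj A] [MonObj B] [IsCommMonObj B] (f : A ⟶ B)
    (σ : A ⟶ A ⊗ A) : IsMultiplier (sepIdem σ (B ◁ f ≫ μ) (f ▷ B ≫ μ)) :=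
  isMultiplier_of_bilinear _ (sepIdem_left_linear f σ) (sepIdem_right_linear f σ)

end Multiplier

section

variable {K : Type*} [Category* K] [MonoidalCategory K]

lemma isMonHom_one (D : K) [MonObj D] : IsMonHom η[D] where
  one_hom := by simp
  mul_hom := by simp [unitors_equal]

lemma isMonHom_mul [BraidedCategory K] (D : K) [MonObj D] [IsCommMonObj D] : IsMonHom μ[D] where
  one_hom := by simp [MonObj.tensorObj.one_def, ← unitors_equal]
  mul_hom := by rw [MonObj.tensorObj.mul_def, Category.assoc, MonObj.mul_mul_mul_comm]

end

/-! ### Existence of splitting towers. -/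

section Existence

variable {K : Type*} [Category* K] [Preadditive K] [MonoidalCategory K]

lemma IsMultiplier.sub [MonoidalPreadditive K] {D : K} [MonObj D] {p q : D ⟶ D}
    (hp : IsMultiplier p) (hq : IsMultiplier q) : IsMultiplier (p - q) where
  left := by
    have : (p - q) ▷ D = p ▷ D - q ▷ D := (tensorRight D).map_sub
    rw [this, Preadditive.sub_comp, hp.left, hq.left, Preadditive.comp_sub]
  right := by
    have : D ◁ (p - q) = D ◁ p - D ◁ q := (tensorLeft D).map_sub
    rw [this, Preadditive.sub_comp, hp.right, hq.right, Preadditive.comp_sub]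

variable [HasBinaryBiproducts K]

lemma isMonHom_lift {P B D : K} [MonObj P] [MonObj B] [MonObj D] (u : P ⟶ B) (v : P ⟶ D)
    [IsMonHom u] [IsMonHom v] : IsMonHom (biprod.lift u v) where
  one_hom := by
    change _ = biprod.lift η η
    ext <;> simp
  mul_hom := by
    change _ = _ ≫ biprod.lift _ _
    ext <;> simp [tensorHom_comp_tensorHom_assoc]

/-- On `B ⊗ B` there are commuting idempotent multipliers: `p`, with image `B ⊗_A B`, and `μ ≫ τ`,
with image `B`. The second lies under the first, so the image `D` of their difference `d` is the
complement of `B` in `B ⊗_A B`. -/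
theorem exists_splitting [SymmetricCategory K] [MonoidalPreadditive K] [IsIdempotentComplete K] (A B : TTRing K)
    (f : A.X ⟶ B.X) [IsMonHom f] :
    ∃ (D : TTRing K) (g : B.X ⟶ D.X), IsMonHom g ∧ IsSplitting f g := by
  obtain ⟨A, hA⟩ := A
  obtain ⟨B, hB⟩ := B
  dsimp only at f ‹IsMonHom f› ⊢
  obtain ⟨σ, h1, h2, h3⟩ := id hA
  obtain ⟨τ, k1, k2, k3⟩ := id hB
  set p := sepIdem σ (B ◁ f ≫ μ) (f ▷ B ≫ μ) with hp
  have pm : IsMultiplier p := isMultiplier_sepIdem f σ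
  -- This is the separability idempotent of `B` over itself.
  have qm : IsMultiplier (μ[B] ≫ τ) := by
    have := isMultiplier_sepIdem (𝟙 B) τ
    rw [whiskerLeft_id, id_whiskerRight, Category.id_comp, sepIdem_self k2 k3] at this
    exact this
  have hpl : (B ◁ f ≫ μ) ▷ B ≫ p = (α_ B A B).hom ≫ B ◁ (f ▷ B ≫ μ) ≫ p := by
    rw [act_left_sepIdem (right_act_assoc f) h2, act_right_sepIdem (left_act_assoc f) h3]
  have hpt : ∀ {Z : K} (t : B ⊗ B ⟶ Z),
      (B ◁ f ≫ μ) ▷ B ≫ t = (α_ B A B).hom ≫ B ◁ (f ▷ B ≫ μ) ≫ t → p ≫ t = t :=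
    fun t ht => sepIdem_comp (right_act_assoc f) h1 (right_act_unit f) t ht
  have pp : p ≫ p = p := hpt p hpl
  have pμ : p ≫ μ = μ := hpt μ (mul_balanced f)
  have qp : (μ ≫ τ) ≫ p = μ ≫ τ := by rw [qm.comm pm, reassoc_of% pμ]
  have τp : τ ≫ p = τ := by
    have := τ ≫= qp
    simpa [reassoc_of% k1] using this
  set d := p - μ ≫ τ with hd
  have dp : d ≫ p = d := by rw [hd, Preadditive.sub_comp, pp, qp]
  have dμ : d ≫ μ = 0 := by simp [hd, pμ, k1]
  have τd : τ ≫ d = 0 := by simp [hd, τp, reassoc_of% k1]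
  have dd : d ≫ d = d := by
    conv_lhs => rw [hd, Preadditive.comp_sub, dp, reassoc_of% dμ, zero_comp, sub_zero]
  have dm : IsMultiplier d := pm.sub qm
  obtain ⟨P, sP, rP, hsP, hrP⟩ := IsIdempotentComplete.idempotents_split _ p pp
  obtain ⟨D, sD, rD, hsD, hrD⟩ := IsIdempotentComplete.idempotents_split _ d dd
  rw [← hrP] at pm
  rw [← hrD] at dm
  let := retractMonObj rP sP hsP pm
  let := retractMonObj rD sD hsD dm
  have := isMonHom_retract rP sP hsP pm
  have := isMonHom_retract rD sD hsD dm
  have prP : p ≫ rP = rP := by rw [← hrP, Category.assoc, hsP, Category.comp_id]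
  have drD : d ≫ rD = rD := by rw [← hrD, Category.assoc, hsD, Category.comp_id]
  have sDd : sD ≫ d = sD := by rw [← hrD, reassoc_of% hsD]
  have pd : p ≫ d = d := by rw [hd, Preadditive.comp_sub, pp, reassoc_of% pμ]
  have prD : p ≫ rD = rD := by rw [← drD, reassoc_of% pd]
  have τrD : τ ≫ rD = 0 := by rw [← drD, reassoc_of% τd, zero_comp]
  have sDp : sD ≫ p = sD := by rw [← sDd, Category.assoc, dp]
  have sDμ : sD ≫ μ = 0 := by rw [← sDd, Category.assoc, dμ, comp_zero]
  have : IsCommMonObj D := IsCommMonObj.of_splitEpi rD sD hsD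
  -- The left inclusion `b ↦ b ⊗ 1`, through which `D` becomes a `B`-algebra.
  let u : B ⟶ B ⊗ B := (ρ_ B).inv ≫ B ◁ η[B]
  have := isMonHom_one B
  have := isMonHom_mul B
  have hu : IsMonHom u := inferInstance
  refine ⟨⟨D, IsSeparable.of_splitEpi rD sD hsD (hB.tensor hB)⟩, u ≫ rD, inferInstance,
    { X := P
      π := rP
      w := by rw [← prP, ← Category.assoc, ← Category.assoc _ p, hpl]; simp
      isColimit := Cofork.IsColimit.mk _ (fun t => sP ≫ t.π)
        (fun t => by
          have := t.condition
          change rP ≫ sP ≫ t.π = t.π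
          rw [← Category.assoc, hrP]
          exact hpt _ (by simpa using this))
        (fun t m hm => by
          rw [← hm]
          change m = sP ≫ rP ≫ m
          rw [reassoc_of% hsP]) },
    { hom := biprod.lift (sP ≫ μ) (sP ≫ rD)
      inv := biprod.desc (τ ≫ rP) (sD ≫ rP)
      hom_inv_id := by
        have : sP ≫ μ ≫ τ ≫ rP + sP ≫ d ≫ rP = 𝟙 P := by
          rw [← Preadditive.comp_add, ← Category.assoc, ← Preadditive.add_comp, hd,
            add_sub_cancel, prP, hsP]
        simpa [← hrD] using this
      inv_hom_id := by
        ext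
        · simp [reassoc_of% hrP, pμ, k1]
        · simp [reassoc_of% hrP, prD, τrD]
        · simp [reassoc_of% hrP, pμ, sDμ]
        · simp [reassoc_of% hrP, prD, hsD] }, ?_, ?_, ?_⟩
  · have : IsMonHom (sP ≫ μ[B]) := by
      refine IsMonHom.of_splitEpi_comp rP sP hsP _ ?_
      rw [← Category.assoc, hrP, pμ]
      infer_instance
    have : IsMonHom (sP ≫ rD) := by
      refine IsMonHom.of_splitEpi_comp rP sP hsP _ ?_
      rw [← Category.assoc, hrP, prD]
      infer_instance
    exact isMonHom_lift _ _
  · simp [reassoc_of% hrP, pμ]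
  · ext
    · simp [reassoc_of% hrP, pμ]
    · simp [u, reassoc_of% hrP, prD]

/-- The unit object as a tt-ring. -/
def unit (K : Type*) [Category* K] [MonoidalCategory K] [BraidedCategory K] : TTRing K where
  X := 𝟙_ K
  separable := ⟨(λ_ (𝟙_ K)).inv, by simp, by simp; monoidal, by simp; monoidal⟩

theorem exists_splittingTower [SymmetricCategory K] [MonoidalPreadditive K]
    [IsIdempotentComplete K] (A : TTRing K) : Nonempty (SplittingTower A) := by
  choose D g hg hs using fun (A B : TTRing K) (f : A.X ⟶ B.X) (_ : IsMonHom f) =>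
    exists_splitting A B f
  -- The recursion runs over ring homomorphisms, since the next stage depends on the last transition
  -- map and not only on its target.
  let S := Σ' (A B : TTRing K) (f : A.X ⟶ B.X), IsMonHom f
  let next : S → S := fun x => ⟨x.2.1, D _ _ x.2.2.1 x.2.2.2, g _ _ _ _, hg _ _ _ _⟩
  let st : ℕ → S := fun n => Nat.rec ⟨unit K, A, η[A.X], isMonHom_one A.X⟩ (fun _ x => next x) n
  exact ⟨{
    obj n := (st n).1
    map n := (st n).2.2.1
    isMonHom_map n := (st n).2.2.2
    isoZero := Iso.refl _
    isMonHom_isoZero := inferInstanceAs (IsMonHom (𝟙 (𝟙_ K)))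
    isoOne := Iso.refl _
    isMonHom_isoOne := inferInstanceAs (IsMonHom (𝟙 A.X))
    splitting n := hs _ _ _ (st n).2.2.2 }⟩

end Existence

/-! ### Modules over a ring object, free modules and linear maps. -/

section Modules

variable {K : Type*} [Category* K] [MonoidalCategory K]

/-- The axioms of a left action of a ring object `B` on an object `N`. -/
structure IsAction {B N : K} [MonObj B] (ν : B ⊗ N ⟶ N) : Prop where
  one : η ▷ N ≫ ν = (λ_ N).hom
  mul : μ ▷ N ≫ ν = (α_ B B N).hom ≫ B ◁ ν ≫ ν

/-- Linearity of a morphism for two actions of `B`. -/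
def IsLinear {B M N : K} (ν : B ⊗ M ⟶ M) (ν' : B ⊗ N ⟶ N) (k : M ⟶ N) : Prop :=
  ν ≫ k = B ◁ k ≫ ν'

lemma IsLinear.comp {B M N P : K} {ν : B ⊗ M ⟶ M} {ν' : B ⊗ N ⟶ N} {ν'' : B ⊗ P ⟶ P}
    {k : M ⟶ N} {l : N ⟶ P} (hk : IsLinear ν ν' k) (hl : IsLinear ν' ν'' l) :
    IsLinear ν ν'' (k ≫ l) := by
  rw [IsLinear, ← Category.assoc, hk, Category.assoc, hl, whiskerLeft_comp_assoc]

lemma IsLinear.restrict {A B M N : K} {ν : B ⊗ M ⟶ M} {ν' : B ⊗ N ⟶ N} {k : M ⟶ N}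
    (hk : IsLinear ν ν' k) (f : A ⟶ B) : IsLinear (f ▷ M ≫ ν) (f ▷ N ≫ ν') k := by
  rw [IsLinear, Category.assoc, hk, whisker_exchange_assoc]

variable {B N : K} [MonObj B] {ν : B ⊗ N ⟶ N}

lemma IsAction.mul_flip (hν : IsAction ν) :
    B ◁ ν ≫ ν = (α_ B B N).inv ≫ μ ▷ N ≫ ν := by
  rw [hν.mul, Iso.inv_hom_id_assoc]

lemma isAction_free (X : K) : IsAction ((α_ B B X).inv ≫ μ ▷ X) where
  one := by
    rw [associator_inv_naturality_left_assoc, ← comp_whiskerRight, MonObj.one_mul]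
    simp
  mul := by
    rw [associator_inv_naturality_left_assoc, ← comp_whiskerRight, MonObj.mul_assoc]
    simp

lemma IsAction.restrict {A : K} [MonObj A] (hν : IsAction ν) (f : A ⟶ B) [IsMonHom f] :
    IsAction (f ▷ N ≫ ν) where
  one := by rw [← comp_whiskerRight_assoc, IsMonHom.one_hom, hν.one]
  mul := by
    rw [← comp_whiskerRight_assoc, IsMonHom.mul_hom, tensorHom_def']
    simp only [hν.mul, Category.assoc, comp_whiskerRight, whiskerLeft_comp, whisker_exchange_assoc]
    simp

lemma isAction_mul : IsAction μ[B] where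
  one := by simp
  mul := by simp

/-- The linear extension of `u : X ⟶ N` to the free module `B ⊗ X`. -/
lemma isLinear_free (hν : IsAction ν) {X : K} (u : X ⟶ N) :
    IsLinear ((α_ B B X).inv ≫ μ ▷ X) ν (B ◁ u ≫ ν) := by
  rw [IsLinear, whiskerLeft_comp_assoc, hν.mul_flip, associator_inv_naturality_right_assoc,
    whisker_exchange_assoc, Category.assoc]

/-- The map is `b ↦ b · u`. With `one_comp_orbit` and `IsLinear.orbit_one` this identifies linear
maps `B ⟶ N` with maps `𝟙_ K ⟶ N`. -/
lemma isLinear_orbit (hν : IsAction ν) (u : 𝟙_ K ⟶ N) :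
    IsLinear μ[B] ν ((ρ_ B).inv ≫ B ◁ u ≫ ν) := by
  rw [IsLinear, rightUnitor_inv_naturality_assoc, whiskerLeft_comp_assoc, whiskerLeft_comp_assoc,
    hν.mul_flip, associator_inv_naturality_right_assoc, whisker_exchange_assoc]
  simp

lemma one_comp_orbit (hν : IsAction ν) (u : 𝟙_ K ⟶ N) :
    η[B] ≫ (ρ_ B).inv ≫ B ◁ u ≫ ν = u := by
  rw [rightUnitor_inv_naturality_assoc, ← whisker_exchange_assoc, hν.one]
  simp [← unitors_inv_equal]

lemma IsLinear.orbit_one {k : B ⟶ N} (hk : IsLinear μ ν k) :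
    (ρ_ B).inv ≫ B ◁ (η ≫ k) ≫ ν = k := by
  rw [whiskerLeft_comp_assoc, ← hk]
  simp

end Modules

/-! ### The structure of `A^(n) ⊗ A` in a splitting tower. -/

section Splitting

/-- In elements, `(x ⊗ 1)(1 ⊗ y) = x ⊗ y`. -/
lemma tensor_mul_one_one {K : Type*} [Category* K] [MonoidalCategory K] [BraidedCategory K] (B : K) [MonObj B] :
    ((ρ_ B).inv ≫ B ◁ η ⊗ₘ (λ_ B).inv ≫ η ▷ B) ≫ μ[B ⊗ B] = 𝟙 _ := by
  rw [MonObj.tensorObj.mul_def]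
  rw [← tensorHom_comp_tensorHom, ← id_tensorHom, ← tensorHom_id, Category.assoc,
    tensorμ_natural_assoc, tensorHom_comp_tensorHom, id_tensorHom, tensorHom_id, MonObj.mul_one,
    MonObj.one_mul]
  rw [tensorμ, braiding_tensorUnit_left]
  monoidal

variable {K : Type*} [Category* K] [Preadditive K] [MonoidalCategory K] [MonoidalPreadditive K]

lemma IsLinear.add {B M N : K} {ν : B ⊗ M ⟶ M} {ν' : B ⊗ N ⟶ N} {k l : M ⟶ N}
    (hk : IsLinear ν ν' k) (hl : IsLinear ν ν' l) : IsLinear ν ν' (k + l) := by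
  rw [IsLinear, Preadditive.comp_add, hk, hl, MonoidalPreadditive.whiskerLeft_add,
    Preadditive.add_comp]

variable [HasBinaryBiproducts K] [SymmetricCategory K]

/-- Over the target `B` of a splitting with complement `C`, the `A`-linear maps from `B` to a
`B`-module `N` are the sums of a map `B ⟶ N` and a map `C ⟶ N` which are `B`-linear, in a unique
way. Here `C` is reached through the map `q : y ↦ pr₂ (1 ⊗ y)`. -/
theorem IsSplitting.exists_decomposition {A B C : K} [MonObj A] [MonObj B] [MonObj C]
    {f : A ⟶ B} {g : B ⟶ C}
    [IsMonHom f] (hA : IsSeparable A) (hfg : IsSplitting f g) :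
    ∃ (q : B ⟶ C), IsLinear (f ▷ B ≫ μ) (f ▷ C ≫ g ▷ C ≫ μ) q ∧
      ∀ {N : K} {ν : B ⊗ N ⟶ N} (_ : IsAction ν),
        (∀ k : B ⟶ N, IsLinear (f ▷ B ≫ μ) (f ▷ N ≫ ν) k →
          ∃ (u : 𝟙_ K ⟶ N) (v : C ⟶ N), IsLinear (g ▷ C ≫ μ) ν v ∧
            (ρ_ B).inv ≫ B ◁ u ≫ ν + q ≫ v = k) ∧
        ∀ (u u' : 𝟙_ K ⟶ N) (v v' : C ⟶ N), IsLinear (g ▷ C ≫ μ) ν v →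
          IsLinear (g ▷ C ≫ μ) ν v' →
          (ρ_ B).inv ≫ B ◁ u ≫ ν + q ≫ v = (ρ_ B).inv ≫ B ◁ u' ≫ ν + q ≫ v' →
          u = u' ∧ v = v' := by
  obtain ⟨P, h, hh, h1, h2⟩ := hfg
  obtain ⟨σ, s1, s2, s3⟩ := hA
  -- a section of the projection
  set p := sepIdem σ (B ◁ f ≫ μ) (f ▷ B ≫ μ) with hp
  have hpl : (B ◁ f ≫ μ) ▷ B ≫ p = ((α_ B A B).hom ≫ B ◁ (f ▷ B ≫ μ)) ≫ p := by
    rw [act_left_sepIdem (right_act_assoc f) s2, Category.assoc,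
      act_right_sepIdem (left_act_assoc f) s3]
  obtain ⟨s, hs⟩ : ∃ s : P.X ⟶ B ⊗ B, P.π ≫ s = p :=
    ⟨_, P.isColimit.fac (Cofork.ofπ p hpl) WalkingParallelPair.one⟩
  have pπ : p ≫ P.π = P.π :=
    sepIdem_comp (right_act_assoc f) s1 (right_act_unit f) _ (by simpa using P.w)
  have epi : ∀ {Z : K} (t t' : P.X ⟶ Z), P.π ≫ t = P.π ≫ t' → t = t' :=
    fun t t' e => Cofork.IsColimit.hom_ext P.isColimit e
  have sπ : s ≫ P.π = 𝟙 _ := epi _ _ (by rw [reassoc_of% hs, pπ, Category.comp_id])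
  -- The coprojections `x ↦ x ⊗ 1` and `y ↦ 1 ⊗ y`. Extension of scalars along `j` turns `A`-linear
  -- maps `B ⟶ N` into `B`-linear maps `P.X ⟶ N`, and `P.X` is `B × C`.
  set inc : B ⟶ P.X := (ρ_ B).inv ≫ B ◁ η ≫ P.π with hinc
  set j : B ⟶ P.X := (λ_ B).inv ≫ η ▷ B ≫ P.π with hj
  have : IsMonHom inc := by
    have := isMonHom_one B
    infer_instance
  have πfac : P.π = (inc ⊗ₘ j) ≫ μ := by
    have : (inc ⊗ₘ j) = ((ρ_ B).inv ≫ B ◁ η ⊗ₘ (λ_ B).inv ≫ η ▷ B) ≫ (P.π ⊗ₘ P.π) := by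
      simp [hinc, hj, tensorHom_comp_tensorHom]
    rw [this, Category.assoc, ← IsMonHom.mul_hom, reassoc_of% tensor_mul_one_one B]
  -- the two components of `h`
  obtain ⟨a, ha⟩ : ∃ a, a = h.hom ≫ biprod.fst := ⟨_, rfl⟩
  obtain ⟨b, hb⟩ : ∃ b, b = h.hom ≫ biprod.snd := ⟨_, rfl⟩
  obtain ⟨i, hi⟩ : ∃ i, i = biprod.inl ≫ h.inv := ⟨_, rfl⟩
  obtain ⟨i', hi'⟩ : ∃ i, i = biprod.inr ≫ h.inv := ⟨_, rfl⟩
  have ia : i ≫ a = 𝟙 B := by simp [hi, ha]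
  have ib : i ≫ b = 0 := by simp [hi, hb]
  have ia' : i' ≫ a = 0 := by simp [hi', ha]
  have ib' : i' ≫ b = 𝟙 C := by simp [hi', hb]
  have tot : a ≫ i + b ≫ i' = 𝟙 P.X := by
    rw [ha, hb, hi, hi', Category.assoc, Category.assoc, ← Preadditive.comp_add, ← Category.assoc,
      ← Category.assoc biprod.snd, ← Preadditive.add_comp, biprod.total]
    simp
  have am : μ ≫ a = (a ⊗ₘ a) ≫ μ := by
    have := hh.mul_hom =≫ biprod.fst
    change _ = (_ ≫ biprod.lift _ _) ≫ _ at this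
    simpa [ha, tensorHom_comp_tensorHom_assoc] using this
  have bm : μ ≫ b = (b ⊗ₘ b) ≫ μ := by
    have := hh.mul_hom =≫ biprod.snd
    change _ = (_ ≫ biprod.lift _ _) ≫ _ at this
    simpa [hb, tensorHom_comp_tensorHom_assoc] using this
  have inca : inc ≫ a = 𝟙 B := by simpa [ha, hinc] using h2 =≫ biprod.fst
  have incb : inc ≫ b = g := by simpa [hb, hinc] using h2 =≫ biprod.snd
  have ja : j ≫ a = 𝟙 B := by simp [hj, ha, h1]
  have ext2 : ∀ {Z : K} (t t' : Z ⟶ P.X), t ≫ a = t' ≫ a → t ≫ b = t' ≫ b → t = t' := by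
    intro Z t t' e e'
    rw [← Category.comp_id t, ← Category.comp_id t', ← tot]
    simp only [Preadditive.comp_add, reassoc_of% e, reassoc_of% e']
  -- linearity
  have la : IsLinear (inc ▷ P.X ≫ μ) μ a := by
    rw [IsLinear, Category.assoc, am, whiskerRight_comp_tensorHom_assoc, inca, id_tensorHom]
  have lb : IsLinear (inc ▷ P.X ≫ μ) (g ▷ C ≫ μ) b := by
    rw [IsLinear, Category.assoc, bm, whiskerRight_comp_tensorHom_assoc, incb, tensorHom_def',
      Category.assoc]
  have hπj : P.π = B ◁ j ≫ inc ▷ P.X ≫ μ := by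
    rw [← MonoidalCategory.tensorHom_def'_assoc, ← πfac]
  have aP : IsAction (inc ▷ P.X ≫ μ) := isAction_mul.restrict inc
  -- In `B ⊗_A B` one has `1 ⊗ ay = a ⊗ y`: evaluate the coequalizer relation at `1 ⊗ a ⊗ y`.
  have lj : IsLinear (f ▷ B ≫ μ) (f ▷ P.X ≫ inc ▷ P.X ≫ μ) j := by
    rw [IsLinear, whisker_exchange_assoc, ← hπj]
    have e := (λ_ A).inv ▷ B ≫= (η ▷ A) ▷ B ≫= P.w
    have e1 : (λ_ A).inv ▷ B ≫ (η[B] ▷ A) ▷ B ≫ (B ◁ f ≫ μ) ▷ B = f ▷ B := by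
      rw [← comp_whiskerRight, ← comp_whiskerRight, ← whisker_exchange_assoc, MonObj.one_mul]
      simp
    have e2 : (λ_ A).inv ▷ B ≫ (η[B] ▷ A) ▷ B ≫ (α_ B A B).hom ≫ B ◁ (f ▷ B ≫ μ) =
        f ▷ B ≫ μ ≫ (λ_ B).inv ≫ η ▷ B := by
      rw [associator_naturality_left_assoc, ← whisker_exchange, leftUnitor_inv_naturality_assoc]
      simp
    rw [reassoc_of% e1, Category.assoc, reassoc_of% e2] at e
    rw [e, hj, Category.assoc]
  generalize inc ▷ P.X ≫ μ = act at *
  have li : IsLinear μ (act) i := by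
    apply ext2
    · rw [Category.assoc, ia, Category.assoc, la, ← whiskerLeft_comp_assoc, ia]
      simp
    · rw [Category.assoc, ib, Category.assoc, lb, ← whiskerLeft_comp_assoc, ib]
      simp
  have li' : IsLinear (g ▷ C ≫ μ) (act) i' := by
    apply ext2
    · rw [Category.assoc, Category.assoc, ia', Category.assoc, la, ← whiskerLeft_comp_assoc, ia']
      simp
    · rw [Category.assoc, Category.assoc, ib', Category.assoc, lb, ← whiskerLeft_comp_assoc, ib']
      simp
  have lπ : IsLinear ((α_ B B B).inv ≫ μ ▷ B) (act) P.π := by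
    have := isLinear_free aP j
    rwa [← hπj] at this
  refine ⟨j ≫ b, ?_, fun {N ν} hν => ⟨fun k hk => ?_, fun u u' v v' hv hv' e => ?_⟩⟩
  · exact lj.comp (lb.restrict f)
  · have hcond : (B ◁ f ≫ μ) ▷ B ≫ B ◁ k ≫ ν =
        ((α_ B A B).hom ≫ B ◁ (f ▷ B ≫ μ)) ≫ B ◁ k ≫ ν := by
      rw [← whisker_exchange_assoc, comp_whiskerRight_assoc, hν.mul, Category.assoc,
        ← whiskerLeft_comp_assoc, hk]
      simp
    obtain ⟨k', hk'⟩ : ∃ k' : P.X ⟶ N, P.π ≫ k' = B ◁ k ≫ ν :=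
      ⟨_, P.isColimit.fac (Cofork.ofπ (B ◁ k ≫ ν) hcond) WalkingParallelPair.one⟩
    have jk : j ≫ k' = k := by
      rw [hj, Category.assoc, Category.assoc, hk', ← whisker_exchange_assoc, hν.one]
      simp
    have lk' : IsLinear (act) ν k' := by
      -- The projection `P.π` is split, so it stays epi after tensoring with `B` and linearity can
      -- be tested on `B ⊗ (B ⊗ B)`.
      have hsp : B ◁ s ≫ B ◁ P.π = 𝟙 _ := by rw [← whiskerLeft_comp, sπ, whiskerLeft_id]
      have e : B ◁ P.π ≫ act ≫ k' = B ◁ P.π ≫ B ◁ k' ≫ ν := by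
        rw [← Category.assoc, ← lπ, Category.assoc, hk', ← whiskerLeft_comp_assoc, hk']
        exact isLinear_free hν k
      simpa only [IsLinear, reassoc_of% hsp] using B ◁ s ≫= e
    have lik : IsLinear μ ν (i ≫ k') := li.comp lk'
    refine ⟨η ≫ i ≫ k', i' ≫ k', li'.comp lk', ?_⟩
    rw [lik.orbit_one]
    have := j ≫= tot =≫ k'
    simpa [reassoc_of% ja, jk] using this
  -- Equal restrictions along `j` have equal linear extensions to `P.X`; the components are then
  -- read off along `i` and `i'`.
  · have key : ∀ (u : 𝟙_ K ⟶ N) (v : C ⟶ N), IsLinear (g ▷ C ≫ μ) ν v →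
        P.π ≫ (a ≫ (ρ_ B).inv ≫ B ◁ u ≫ ν + b ≫ v) =
          B ◁ ((ρ_ B).inv ≫ B ◁ u ≫ ν + (j ≫ b) ≫ v) ≫ ν := by
      intro u v hv
      have lin := (la.comp (isLinear_orbit hν u)).add (lb.comp hv)
      conv_lhs => rw [hπj]
      rw [Category.assoc, lin, ← whiskerLeft_comp_assoc, Preadditive.comp_add, reassoc_of% ja,
        Category.assoc j]
    have e2 := epi _ _ ((key u v hv).trans ((congrArg (fun t => B ◁ t ≫ ν) e).trans
      (key u' v' hv').symm))
    constructor
    · have := η ≫= i ≫= e2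
      simpa only [Preadditive.comp_add, reassoc_of% ia, reassoc_of% ib, zero_comp, comp_zero,
        add_zero, one_comp_orbit hν] using this
    · have := i' ≫= e2
      simpa only [Preadditive.comp_add, reassoc_of% ia', reassoc_of% ib', zero_comp,
        zero_add] using this

/-- `A`-valued maps decompose: every map from `A` to a `B`-module `N` is uniquely the sum of a map
factoring through the free module `B ⊗ U` and of one factoring through a linear map `C ⟶ N`. -/
structure IsDecomposition {A B C U : K} [MonObj B] [MonObj C] (g : B ⟶ C) (α : A ⟶ B ⊗ U)
    (β : A ⟶ C) : Prop where
  exists_eq {N : K} {ν : B ⊗ N ⟶ N} (hν : IsAction ν) (k : A ⟶ N) :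
    ∃ (u : U ⟶ N) (v : C ⟶ N), IsLinear (g ▷ C ≫ μ) ν v ∧ α ≫ B ◁ u ≫ ν + β ≫ v = k
  unique {N : K} {ν : B ⊗ N ⟶ N} (hν : IsAction ν) {u u' : U ⟶ N} {v v' : C ⟶ N}
    (hv : IsLinear (g ▷ C ≫ μ) ν v) (hv' : IsLinear (g ▷ C ≫ μ) ν v')
    (h : α ≫ B ◁ u ≫ ν + β ≫ v = α ≫ B ◁ u' ≫ ν + β ≫ v') : u = u' ∧ v = v'

/-- Restrict a `B`-module `N` along `f`: `Hom(X, N) = Hom(U, N) × Hom_A(B, N)`, and the splitting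
gives `Hom_A(B, N) = Hom(𝟙, N) × Hom_B(C, N)`. Each stage thus adds one unit summand to `U`. -/
theorem IsDecomposition.step {X A B C U : K} [MonObj A] [MonObj B] [MonObj C] {f : A ⟶ B}
    {g : B ⟶ C} {α : X ⟶ A ⊗ U} {β : X ⟶ B} [IsMonHom f] (hA : IsSeparable A)
    (h : IsDecomposition f α β) (hfg : IsSplitting f g) :
    ∃ (α' : X ⟶ B ⊗ (U ⊞ 𝟙_ K)) (β' : X ⟶ C), IsDecomposition g α' β' := by
  obtain ⟨q, hq, H⟩ := hfg.exists_decomposition hA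
  let α' := α ≫ f ▷ U ≫ B ◁ (biprod.inl : U ⟶ U ⊞ 𝟙_ K) +
    β ≫ (ρ_ B).inv ≫ B ◁ (biprod.inr : 𝟙_ K ⟶ U ⊞ 𝟙_ K)
  have hα' : ∀ {N : K} (ν : B ⊗ N ⟶ N) (w : U ⊞ 𝟙_ K ⟶ N), α' ≫ B ◁ w ≫ ν =
      α ≫ A ◁ (biprod.inl ≫ w) ≫ f ▷ N ≫ ν +
        β ≫ (ρ_ B).inv ≫ B ◁ (biprod.inr ≫ w) ≫ ν := by
    intro N ν w
    simp only [α', Preadditive.add_comp, Category.assoc, whisker_exchange_assoc, whiskerLeft_comp]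
  refine ⟨α', β ≫ q, ⟨fun {N ν} hν k => ?_, fun {N ν} hν {w w' v v'} hv hv' e => ?_⟩⟩
  · obtain ⟨u, v, hv, rfl⟩ := h.exists_eq (hν.restrict f) k
    obtain ⟨u', v', hv', rfl⟩ := (H hν).1 v hv
    refine ⟨biprod.desc u u', v', hv', ?_⟩
    rw [hα']
    simp [add_assoc]
  · have lin : ∀ (u : 𝟙_ K ⟶ N) (v : C ⟶ N), IsLinear (g ▷ C ≫ μ) ν v →
        IsLinear (f ▷ B ≫ μ) (f ▷ N ≫ ν) ((ρ_ B).inv ≫ B ◁ u ≫ ν + q ≫ v) :=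
      fun u v hv => ((isLinear_orbit hν u).restrict f).add (hq.comp (hv.restrict f))
    have sum : ∀ (w : U ⊞ 𝟙_ K ⟶ N) (v : C ⟶ N), α' ≫ B ◁ w ≫ ν + (β ≫ q) ≫ v =
        α ≫ A ◁ (biprod.inl ≫ w) ≫ f ▷ N ≫ ν +
          β ≫ ((ρ_ B).inv ≫ B ◁ (biprod.inr ≫ w) ≫ ν + q ≫ v) := by
      intro w v
      rw [hα', Preadditive.comp_add, Category.assoc, add_assoc]
    rw [sum, sum] at e
    obtain ⟨e1, e2⟩ := h.unique (hν.restrict f) (lin _ v hv) (lin _ v' hv') e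
    obtain ⟨e3, e4⟩ := (H hν).2 _ _ v v' hv hv' e2
    exact ⟨biprod.hom_ext' _ _ e1 e3, e4⟩

/-- A decomposition is an isomorphism `B ⊗ A ≅ (B ⊗ U) ⊕ C`. -/
theorem IsDecomposition.nonempty_iso {A B C U : K} [MonObj B] [MonObj C] {g : B ⟶ C}
    {α : A ⟶ B ⊗ U} {β : A ⟶ C} [IsMonHom g] (h : IsDecomposition g α β) :
    Nonempty (B ⊗ A ≅ (B ⊗ U) ⊞ C) := by
  have hC : IsAction (g ▷ C ≫ μ) := isAction_mul.restrict g
  have hU : IsAction ((α_ B B U).inv ≫ μ ▷ U) := isAction_free U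
  have hA : IsAction ((α_ B B A).inv ≫ μ ▷ A) := isAction_free A
  have free : ∀ {X N : K} {ν : B ⊗ N ⟶ N} (w : B ⊗ X ⟶ N),
      IsLinear ((α_ B B X).inv ≫ μ ▷ X) ν w →
      B ◁ ((λ_ X).inv ≫ η ▷ X ≫ w) ≫ ν = w := by
    intro X N ν w hw
    rw [whiskerLeft_comp_assoc, whiskerLeft_comp_assoc, ← hw, Category.assoc,
      associator_inv_naturality_middle_assoc, ← comp_whiskerRight_assoc, MonObj.mul_one]
    simp
  have uniq : ∀ {X N : K} {ν : B ⊗ N ⟶ N} (w w' : B ⊗ X ⟶ N),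
      IsLinear ((α_ B B X).inv ≫ μ ▷ X) ν w → IsLinear ((α_ B B X).inv ≫ μ ▷ X) ν w' →
      (λ_ X).inv ≫ η ▷ X ≫ w = (λ_ X).inv ≫ η ▷ X ≫ w' → w = w' := by
    intro X N ν w w' hw hw' e
    rw [← free w hw, e, free w' hw']
  have one : ∀ {X N : K} {ν : B ⊗ N ⟶ N} (_ : IsAction ν) (u : X ⟶ N),
      (λ_ X).inv ≫ η ▷ X ≫ B ◁ u ≫ ν = u := by
    intro X N ν hν u
    rw [← whisker_exchange_assoc, hν.one]
    simp
  -- Yoneda: decomposing the universal map from `A` to the free module `B ⊗ A` yields the inverse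
  -- isomorphism.
  obtain ⟨u, v, hv, e⟩ := h.exists_eq hA ((λ_ A).inv ≫ η ▷ A)
  let ext := B ◁ u ≫ (α_ B B A).inv ≫ μ ▷ A
  have lext : IsLinear ((α_ B B U).inv ≫ μ ▷ U) ((α_ B B A).inv ≫ μ ▷ A) ext := isLinear_free hA u
  have eα := isLinear_free hU α
  have eβ := isLinear_free hC β
  have key : ∀ {N : K} {ν : B ⊗ N ⟶ N} (_ : IsAction ν) (k : A ⟶ N),
      α ≫ ext ≫ B ◁ k ≫ ν + β ≫ v ≫ B ◁ k ≫ ν = k := by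
    intro N ν hν k
    have := e =≫ (B ◁ k ≫ ν)
    simpa only [Preadditive.add_comp, Category.assoc, one hν k, ext] using this
  refine ⟨⟨biprod.lift (B ◁ α ≫ (α_ B B U).inv ≫ μ ▷ U) (B ◁ β ≫ g ▷ C ≫ μ), biprod.desc ext v,
    ?_, ?_⟩⟩
  · have lin := (eα.comp lext).add (eβ.comp hv)
    rw [biprod.lift_desc]
    refine uniq _ _ lin (by simp [IsLinear]) ?_
    simp only [Preadditive.comp_add, Category.assoc, Category.comp_id, reassoc_of% one hU α,
      reassoc_of% one hC β]
    exact e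
  -- For the other composite, `α` and `β` are decomposed in two ways: through `ext` and `v`, and
  -- tautologically. Uniqueness identifies the four matrix entries.
  · have k1 := key hU α
    have k2 := key hC β
    rw [← free _ (lext.comp eα)] at k1
    rw [← free _ (lext.comp eβ)] at k2
    have z : IsLinear (g ▷ C ≫ μ) ((α_ B B U).inv ≫ μ ▷ U) 0 := by simp [IsLinear]
    have idC : IsLinear (g ▷ C ≫ μ) (g ▷ C ≫ μ) (𝟙 C) := by simp [IsLinear]
    have idU : IsLinear ((α_ B B U).inv ≫ μ ▷ U) ((α_ B B U).inv ≫ μ ▷ U) (𝟙 _) := by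
      simp [IsLinear]
    obtain ⟨a1, a2⟩ := h.unique hU (u' := (λ_ U).inv ≫ η ▷ U ≫ 𝟙 _) (hv.comp eα) z
      (k1.trans (by rw [free _ idU]; simp))
    obtain ⟨b1, b2⟩ := h.unique hC (u' := 0) (hv.comp eβ) idC (k2.trans (by simp))
    have c1 := uniq _ _ (lext.comp eα) idU a1
    have c2 := free _ (lext.comp eβ)
    rw [b1] at c2
    ext
    · simpa using c1
    · simpa using c2.symm
    · simpa using a2
    · simpa using b2

open ZeroObject in
/-- The sum of `n` copies of the unit object. -/
noncomputable def copies (K : Type*) [Category* K] [Preadditive K] [HasBinaryBiproducts K]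
    [MonoidalCategory K] [HasZeroObject K] : ℕ → K
  | 0 => 0
  | n + 1 => copies K n ⊞ 𝟙_ K

/-- In a splitting tower, `A^(n) ⊗ A` is the sum of `n` copies of `A^(n)` and of `A^(n+1)`. -/
theorem SplittingTower.exists_decomposition [HasZeroObject K] {A : TTRing K}
    (T : SplittingTower A) (n : ℕ) :
    ∃ (α : A.X ⟶ (T.obj n).X ⊗ copies K n) (β : A.X ⟶ (T.obj (n + 1)).X),
      IsDecomposition (T.map n) α β := by
  induction n with
  | zero =>
    -- The unit of `A^(0)` is an isomorphism, so linearity over `A^(0)` is automatic; the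
    -- decomposition then has `U = 0`.
    have lin : ∀ {N : K} {ν : (T.obj 0).X ⊗ N ⟶ N} (_ : IsAction ν) (k : (T.obj 1).X ⟶ N),
        IsLinear (T.map 0 ▷ (T.obj 1).X ≫ μ) ν k := by
      intro N ν hν k
      have := T.isMonHom_map 0
      have := T.isMonHom_isoZero
      have hη : η[(T.obj 0).X] = T.isoZero.inv := by
        have := IsMonHom.one_hom T.isoZero.inv
        simpa using this.symm
      have : IsIso η[(T.obj 0).X] := by rw [hη]; infer_instance
      rw [IsLinear, ← cancel_epi (η[(T.obj 0).X] ▷ (T.obj 1).X), Category.assoc,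
        ← comp_whiskerRight_assoc, IsMonHom.one_hom, ← whisker_exchange_assoc, hν.one]
      simp
    exact ⟨0, T.isoOne.inv, ⟨fun {N ν} hν k => ⟨0, T.isoOne.hom ≫ k, lin hν _, by simp⟩,
      fun {N ν} hν {u u' v v'} _ _ e =>
        ⟨(isZero_zero K).eq_of_src u u', by simpa using e⟩⟩⟩
  | succ n ih =>
    obtain ⟨α, β, h⟩ := ih
    have := T.isMonHom_map n
    exact h.step (T.obj n).separable (T.splitting n)

end Splitting
end TTRing

namespace TTRing

/-! ### Counting the summands of a direct sum decomposition. -/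

section Decomposition

/-- A presentation of an object as a finite direct sum of objects of a family `S`. -/
structure SumDecomposition {C : Type*} [Category* C] [Preadditive C] {I : Type*} (S : I → C)
    (X : C) (J : Type) [Fintype J] where
  idx : J → I
  inc (j : J) : S (idx j) ⟶ X
  proj (j : J) : X ⟶ S (idx j)
  inc_proj (j : J) : inc j ≫ proj j = 𝟙 _
  inc_proj_ne {j j' : J} (h : j ≠ j') : inc j ≫ proj j' = 0
  total : ∑ j, proj j ≫ inc j = 𝟙 X

/-- A family of multiplicative functions on the endomorphism rings of the objects of a family with
values in a field, which is invariant under cyclic permutation. -/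
structure CyclicCharacter {C : Type*} [Category* C] [Preadditive C] {I : Type*} (S : I → C)
    (κ : Type*) [Field κ] where
  app (a : I) : (S a ⟶ S a) →+ κ
  map_id (a : I) : app a (𝟙 _) = 1
  map_comp {a : I} (x y : S a ⟶ S a) : app a (x ≫ y) = app a x * app a y
  cyclic {a b : I} (f : S a ⟶ S b) (g : S b ⟶ S a) : app a (f ≫ g) = app b (g ≫ f)

variable {C : Type*} [Category* C] [Preadditive C] {I : Type*} {S : I → C}

namespace CyclicCharacter

variable {κ : Type*} [Field κ] (χ : CyclicCharacter S κ)

/-- The objects `S a` and `S b` are isomorphic modulo the kernel of the character. -/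
def setoid : Setoid I where
  r a b := ∃ (f : S a ⟶ S b) (g : S b ⟶ S a), χ.app a (f ≫ g) ≠ 0
  iseqv :=
    { refl a := ⟨𝟙 _, 𝟙 _, by simp [χ.map_id]⟩
      symm := fun {a b} ⟨f, g, h⟩ => ⟨g, f, by rwa [← χ.cyclic]⟩
      trans := fun {a b c} ⟨f, g, h⟩ ⟨f', g', h'⟩ => ⟨f ≫ f', g' ≫ g, by
        have : χ.app a ((f ≫ f') ≫ g' ≫ g) = χ.app b (f' ≫ g') * χ.app a (f ≫ g) := by
          rw [Category.assoc, χ.cyclic, χ.cyclic f g, ← χ.map_comp]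
          simp
        rw [this]
        exact mul_ne_zero h' h⟩ }

/-- After applying `χ`, morphisms within the class of `c` behave like a one-dimensional space, so
two decompositions give two bases of one vector space. Their transition matrices are mutually
inverse, hence square. -/
lemma card_fiber_eq {X : C} {J J' : Type} [Fintype J] [Fintype J']
    (D : SumDecomposition S X J) (D' : SumDecomposition S X J') (c : I) :
    Nat.card {j // χ.setoid (D.idx j) c} = Nat.card {j // χ.setoid (D'.idx j) c} := by
  classical
  have hc : ∀ a, χ.setoid a c → ∃ (f : S c ⟶ S a) (g : S a ⟶ S c), χ.app c (f ≫ g) ≠ 0 :=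
    fun a h => χ.setoid.symm h
  choose f g hfg using hc
  -- This is the one-dimensionality: by cyclicity, both sides are `χ` of products of the same two
  -- endomorphisms of `S a`.
  have swap : ∀ a (h : χ.setoid a c) (x : S c ⟶ S a) (y : S a ⟶ S c),
      χ.app c (x ≫ g a h) * χ.app c (f a h ≫ y) = χ.app c (f a h ≫ g a h) * χ.app c (x ≫ y) := by
    intro a h x y
    rw [← χ.map_comp, Category.assoc, χ.cyclic x, χ.cyclic (f a h), χ.cyclic x y, ← χ.map_comp]
    simp only [Category.assoc]
  have vanish : ∀ a, ¬ χ.setoid a c → ∀ (x : S c ⟶ S a) (y : S a ⟶ S c), χ.app c (x ≫ y) = 0 := by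
    intro a h x y
    by_contra hne
    exact h (χ.setoid.symm ⟨x, y, hne⟩)
  let M : ∀ {J J' : Type} [Fintype J] [Fintype J'] (D : SumDecomposition S X J)
    (D' : SumDecomposition S X J'),
    Matrix {j // χ.setoid (D.idx j) c} {j // χ.setoid (D'.idx j) c} κ := fun D D' =>
    Matrix.of fun j j' => χ.app c (f _ j.2 ≫ D.inc j ≫ D'.proj j' ≫ g _ j'.2) /
      χ.app c (f _ j'.2 ≫ g _ j'.2)
  have hM : ∀ {J J' : Type} [Fintype J] [Fintype J'] (D : SumDecomposition S X J)
    (D' : SumDecomposition S X J'), M D D' * M D' D = 1 := by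
    intro J J' _ _ D D'
    ext j k
    have hj := hfg _ k.2
    have h1 : ∀ i : {j // χ.setoid (D'.idx j) c},
          χ.app c (f _ j.2 ≫ D.inc j ≫ D'.proj i ≫ g _ i.2) / χ.app c (f _ i.2 ≫ g _ i.2) *
        (χ.app c (f _ i.2 ≫ D'.inc i ≫ D.proj k ≫ g _ k.2) / χ.app c (f _ k.2 ≫ g _ k.2)) =
        χ.app c (f _ j.2 ≫ D.inc j ≫ (D'.proj i ≫ D'.inc i) ≫ D.proj k ≫ g _ k.2) /
          χ.app c (f _ k.2 ≫ g _ k.2) := by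
      intro i
      have := swap _ i.2 (f _ j.2 ≫ D.inc j ≫ D'.proj i) (D'.inc i ≫ D.proj k ≫ g _ k.2)
      have hi := hfg _ i.2
      simp only [Category.assoc] at this ⊢
      field_simp
      rw [this]
      try ring
    rw [Matrix.mul_apply]
    simp only [M, Matrix.of_apply, h1]
    rw [← Finset.sum_div]
    -- Summands of `D'` outside the class contribute zero, so the partial sum equals the full one,
    -- where `D'.total` applies.
    have h2 : ∑ i : {j // χ.setoid (D'.idx j) c},
        χ.app c (f _ j.2 ≫ D.inc j ≫ (D'.proj i ≫ D'.inc i) ≫ D.proj k ≫ g _ k.2) =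
        χ.app c (f _ j.2 ≫ D.inc j ≫ D.proj k ≫ g _ k.2) := by
      have e : D.inc j ≫ D.proj k ≫ g _ k.2 =
        ∑ i, D.inc j ≫ (D'.proj i ≫ D'.inc i) ≫ D.proj k ≫ g _ k.2 := by
        rw [← Preadditive.comp_sum, ← Preadditive.sum_comp, D'.total, Category.id_comp]
      rw [e, Preadditive.comp_sum, map_sum,
        ← Finset.sum_subtype (Finset.univ.filter fun i => χ.setoid (D'.idx i) c) (by simp)
          (fun i => χ.app c (f _ j.2 ≫ D.inc j ≫ (D'.proj i ≫ D'.inc i) ≫ D.proj k ≫ g _ k.2))]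
      refine Finset.sum_filter_of_ne fun i _ hi => ?_
      by_contra h
      refine hi ?_
      simpa using vanish _ h (f _ j.2 ≫ D.inc j ≫ D'.proj i) (D'.inc i ≫ D.proj k ≫ g _ k.2)
    rw [h2]
    by_cases hjk : j = k
    · subst hjk
      rw [reassoc_of% D.inc_proj, div_self hj, Matrix.one_apply_eq]
    · rw [reassoc_of% D.inc_proj_ne (fun h => hjk (Subtype.ext h)), Matrix.one_apply_ne hjk]
      simp
  rw [Nat.card_eq_fintype_card, Nat.card_eq_fintype_card]
  exact Matrix.square_of_invertible (M D D') (M D' D) (hM D D') (hM D' D)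

/-- Decompositions into objects with a cyclic character all have the same length. -/
theorem card_eq {κ : Type*} [Field κ] (χ : CyclicCharacter S κ) {X : C} {J J' : Type}
    [Fintype J] [Fintype J'] (D : SumDecomposition S X J) (D' : SumDecomposition S X J') :
    Fintype.card J = Fintype.card J' := by
  have key : ∀ q : Quotient χ.setoid,
      Nonempty ({j // Quotient.mk χ.setoid (D.idx j) = q} ≃
        {j // Quotient.mk χ.setoid (D'.idx j) = q}) := by
    intro q
    induction q using Quotient.inductionOn with | _ c => ?_
    have := χ.card_fiber_eq D D' c
    simp only [Quotient.eq]
    exact Finite.card_eq.mp this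
  exact Fintype.card_congr ((Equiv.sigmaFiberEquiv fun j => Quotient.mk χ.setoid (D.idx j)).symm.trans
    ((Equiv.sigmaCongrRight fun q => (key q).some).trans
      (Equiv.sigmaFiberEquiv fun j => Quotient.mk χ.setoid (D'.idx j))))

end CyclicCharacter

namespace SumDecomposition

variable {X Y : C} {J J' : Type} [Fintype J] [Fintype J']

/-- Transport of a decomposition along an isomorphism. -/
def ofIso (D : SumDecomposition S X J) (e : X ≅ Y) : SumDecomposition S Y J where
  idx := D.idx
  inc j := D.inc j ≫ e.hom
  proj j := e.inv ≫ D.proj j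
  inc_proj j := by simp [D.inc_proj]
  inc_proj_ne h := by simp [D.inc_proj_ne h]
  total := by
    have := e.inv ≫= D.total =≫ e.hom
    simpa [Preadditive.comp_sum, Preadditive.sum_comp] using this

/-- Transport of a decomposition along an additive functor. -/
def map {C' : Type*} [Category* C'] [Preadditive C'] (F : C ⥤ C') [F.Additive] {I' : Type*}
    {S' : I' → C'} (D : SumDecomposition S X J) (φ : I → I') (e : ∀ i, F.obj (S i) ≅ S' (φ i)) :
    SumDecomposition S' (F.obj X) J where
  idx j := φ (D.idx j)
  inc j := (e _).inv ≫ F.map (D.inc j)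
  proj j := F.map (D.proj j) ≫ (e _).hom
  inc_proj j := by simp [← F.map_comp_assoc, D.inc_proj]
  inc_proj_ne h := by simp [← F.map_comp_assoc, D.inc_proj_ne h]
  total := by
    simp only [Category.assoc, Iso.hom_inv_id_assoc, ← F.map_comp, ← F.map_sum, D.total, F.map_id]

/-- A finite direct sum of objects with a decomposition. -/
noncomputable def sigma {J : Type} [Fintype J] [HasFiniteBiproducts C] {T : J → Type}
    [∀ j, Fintype (T j)] {X : J → C} (D : ∀ j, SumDecomposition S (X j) (T j)) :
    SumDecomposition S (⨁ X) (Σ j, T j) where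
  idx p := (D p.1).idx p.2
  inc p := (D p.1).inc p.2 ≫ biproduct.ι X p.1
  proj p := biproduct.π X p.1 ≫ (D p.1).proj p.2
  inc_proj p := by simp [(D p.1).inc_proj]
  inc_proj_ne {p q} h := by
    obtain ⟨j, x⟩ := p
    obtain ⟨k, y⟩ := q
    by_cases hjk : j = k
    · subst hjk
      have : x ≠ y := fun e => h (by rw [e])
      simp [(D j).inc_proj_ne this]
    · simp [biproduct.ι_π_ne_assoc _ hjk]
  total := by
    simp only [Category.assoc, Fintype.sum_sigma]
    rw [← biproduct.total]
    refine Finset.sum_congr rfl fun j _ => ?_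
    rw [← Preadditive.comp_sum]
    congr 1
    have := (D j).total =≫ biproduct.ι X j
    simpa only [Preadditive.sum_comp, Category.assoc, Category.id_comp] using this

/-- Every member of the family is decomposed. -/
def single (i : I) : SumDecomposition S (S i) Unit where
  idx _ := i
  inc _ := 𝟙 _
  proj _ := 𝟙 _
  inc_proj _ := by simp
  inc_proj_ne h := (h rfl).elim
  total := by simp

/-- The sum of two objects with a decomposition. -/
noncomputable def sum [HasBinaryBiproducts C] (D : SumDecomposition S X J) (D' : SumDecomposition S Y J') :
    SumDecomposition S (X ⊞ Y) (J ⊕ J') where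
  idx := Sum.elim D.idx D'.idx
  inc
    | .inl j => D.inc j ≫ biprod.inl
    | .inr j => D'.inc j ≫ biprod.inr
  proj
    | .inl j => biprod.fst ≫ D.proj j
    | .inr j => biprod.snd ≫ D'.proj j
  inc_proj
    | .inl j => by simp [D.inc_proj]
    | .inr j => by simp [D'.inc_proj]
  inc_proj_ne {p q} h := by
    rcases p with j | j <;> rcases q with k | k
    · have : j ≠ k := fun e => h (by rw [e])
      simp [D.inc_proj_ne this]
      rfl
    · simp
      rfl
    · simp
      rfl
    · have : j ≠ k := fun e => h (by rw [e])
      simp [D'.inc_proj_ne this]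
      rfl
  total := by
    have h1 := (biprod.fst : X ⊞ Y ⟶ X) ≫= D.total =≫ (biprod.inl : X ⟶ X ⊞ Y)
    have h2 := (biprod.snd : X ⊞ Y ⟶ Y) ≫= D'.total =≫ (biprod.inr : Y ⟶ X ⊞ Y)
    simp only [Preadditive.comp_sum, Preadditive.sum_comp, Category.assoc, Category.id_comp]
      at h1 h2
    rw [Fintype.sum_sum_type]
    refine (congrArg₂ (· + ·) (Eq.trans ?_ h1) (Eq.trans ?_ h2)).trans biprod.total
    · exact Finset.sum_congr rfl fun j _ => Category.assoc _ _ _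
    · exact Finset.sum_congr rfl fun j _ => Category.assoc _ _ _

/-- The tensor product of two objects with a decomposition. -/
def tensor [MonoidalCategory C] [MonoidalPreadditive C] [Add I]
    (e : ∀ i i', S i ⊗ S i' ≅ S (i + i'))
    (D : SumDecomposition S X J) (D' : SumDecomposition S Y J') :
    SumDecomposition S (X ⊗ Y) (J × J') where
  idx p := D.idx p.1 + D'.idx p.2
  inc p := (e _ _).inv ≫ (D.inc p.1 ⊗ₘ D'.inc p.2)
  proj p := (D.proj p.1 ⊗ₘ D'.proj p.2) ≫ (e _ _).hom
  inc_proj p := by simp [tensorHom_comp_tensorHom_assoc, D.inc_proj, D'.inc_proj]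
  inc_proj_ne {p q} h := by
    obtain ⟨j, j'⟩ := p
    obtain ⟨k, k'⟩ := q
    by_cases hjk : j = k
    · have : j' ≠ k' := fun e => h (by rw [e, hjk])
      simp [tensorHom_comp_tensorHom_assoc, D'.inc_proj_ne this]
    · simp [tensorHom_comp_tensorHom_assoc, D.inc_proj_ne hjk]
  total := by
    simp only [Category.assoc, Iso.hom_inv_id_assoc, tensorHom_comp_tensorHom]
    rw [Fintype.sum_prod_type]
    simp only [← tensor_sum, ← sum_tensor, D.total, D'.total]
    simp

end SumDecomposition

end Decomposition

/-! ### Invertible objects and scalars. -/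

section Invertible

variable {C : Type*} [Category* C] [MonoidalCategory C]

/-- The action of the endomorphisms of the unit on an object. -/
def scalar (r : 𝟙_ C ⟶ 𝟙_ C) (X : C) : X ⟶ X := (λ_ X).inv ≫ r ▷ X ≫ (λ_ X).hom

lemma scalar_naturality (r : 𝟙_ C ⟶ 𝟙_ C) {X Y : C} (f : X ⟶ Y) :
    f ≫ scalar r Y = scalar r X ≫ f := by
  simp only [scalar, Category.assoc]
  rw [leftUnitor_inv_naturality_assoc, whisker_exchange_assoc]
  simp

lemma scalar_unit (r : 𝟙_ C ⟶ 𝟙_ C) : scalar r (𝟙_ C) = r := by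
  simp [scalar, unitors_equal, unitors_inv_equal]

lemma scalar_tensor (r : 𝟙_ C ⟶ 𝟙_ C) (X Y : C) : scalar r (X ⊗ Y) = scalar r X ▷ Y := by
  simp [scalar]

lemma scalar_comp (r r' : 𝟙_ C ⟶ 𝟙_ C) (X : C) :
    scalar (r ≫ r') X = scalar r X ≫ scalar r' X := by
  simp [scalar]

/-- The scalar by which an endomorphism of an invertible object acts. -/
def scalarOf {X Y : C} (e : X ⊗ Y ≅ 𝟙_ C) (x : X ⟶ X) : 𝟙_ C ⟶ 𝟙_ C := e.inv ≫ x ▷ Y ≫ e.hom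

lemma scalarOf_scalar {X Y : C} (e : X ⊗ Y ≅ 𝟙_ C) (r : 𝟙_ C ⟶ 𝟙_ C) :
    scalarOf e (scalar r X) = r := by
  rw [scalarOf, ← scalar_tensor, ← scalar_naturality, scalar_unit]
  simp

lemma scalar_scalarOf [BraidedCategory C] {X Y : C} (e : X ⊗ Y ≅ 𝟙_ C) (x : X ⟶ X) :
    scalar (scalarOf e x) X = x := by
  -- Tensoring with `Y` is faithful because tensoring once more with `X` undoes it.
  have faithful : ∀ x y : X ⟶ X, x ▷ Y = y ▷ Y → x = y := by
    intro x y h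
    have h1 : x ▷ (Y ⊗ X) = y ▷ (Y ⊗ X) := by simp [h]
    have h2 : X ◁ ((β_ Y X).hom ≫ e.hom) ≫ x ▷ 𝟙_ C = X ◁ ((β_ Y X).hom ≫ e.hom) ≫ y ▷ 𝟙_ C := by
      rw [whisker_exchange, whisker_exchange, h1]
    rw [cancel_epi] at h2
    simpa using h2
  apply faithful
  rw [← scalar_tensor, ← cancel_mono e.hom, ← scalar_naturality, scalar_unit, scalarOf]
  simp

variable [Preadditive C]

/-- The endomorphism ring of the unit object is commutative. -/
instance endUnitCommRing : CommRing (End (𝟙_ C)) where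
  mul_comm r r' := by
    change r' ≫ r = r ≫ r'
    have := scalar_naturality r r'
    rwa [scalar_unit] at this

/-- The length of a decomposition into invertible objects is well defined. -/
theorem SumDecomposition.card_eq [BraidedCategory C] [MonoidalPreadditive C] {I : Type*} {S : I → C}
    (hS : ∀ i, ∃ T, Nonempty (S i ⊗ T ≅ 𝟙_ C)) (h : ¬ IsZero (𝟙_ C)) {X : C} {J J' : Type}
    [Fintype J] [Fintype J'] (D : SumDecomposition S X J) (D' : SumDecomposition S X J') :
    Fintype.card J = Fintype.card J' := by
  have : Nontrivial (End (𝟙_ C)) := ⟨0, 1, fun e => h ((IsZero.iff_id_eq_zero _).2 e.symm)⟩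
  -- The character sends an endomorphism of `S a` to the residue class of its scalar.
  obtain ⟨m, hm⟩ := Ideal.exists_maximal (End (𝟙_ C))
  let := Ideal.Quotient.field m
  choose T e using hS
  replace e := fun i => (e i).some
  let q : End (𝟙_ C) →+* End (𝟙_ C) ⧸ m := Ideal.Quotient.mk m
  have hcomp : ∀ {a : I} (x y : S a ⟶ S a),
      scalarOf (e a) (x ≫ y) = scalarOf (e a) x ≫ scalarOf (e a) y := by
    intro a x y
    simp [scalarOf]
  refine CyclicCharacter.card_eq (κ := End (𝟙_ C) ⧸ m) {
    app a := AddMonoidHom.mk' (fun x => q (scalarOf (e a) x)) fun x y => ?_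
    map_id a := ?_
    map_comp {a} x y := ?_
    cyclic {a b} f g := ?_ } D D'
  · rw [← map_add]
    congr 1
    simp only [scalarOf, MonoidalPreadditive.add_whiskerRight, Preadditive.add_comp,
      Preadditive.comp_add]
  · change q _ = 1
    rw [← map_one q]
    congr 1
    simp [scalarOf]
  · change q _ = q _ * q _
    -- Multiplication in `End` is composition in the reverse order.
    rw [hcomp, mul_comm, ← map_mul]
    rfl
  · change q _ = q _
    obtain ⟨r, hr⟩ : ∃ r, r = scalarOf (e a) (f ≫ g) := ⟨_, rfl⟩
    obtain ⟨r', hr'⟩ : ∃ r', r' = scalarOf (e b) (g ≫ f) := ⟨_, rfl⟩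
    rw [← hr, ← hr']
    have h1 : scalar r (S a) = f ≫ g := by rw [hr, scalar_scalarOf]
    have h2 : scalar r' (S b) = g ≫ f := by rw [hr', scalar_scalarOf]
    -- The identities `r² = r'r` and `r'² = rr'` suffice: in a field they force equal images, also
    -- when one image vanishes.
    have e1 : r ≫ r = r' ≫ r := by
      rw [← scalarOf_scalar (e a) (r ≫ r), ← scalarOf_scalar (e a) (r' ≫ r), scalar_comp,
        scalar_comp]
      congr 1
      calc scalar r (S a) ≫ scalar r (S a) = f ≫ (g ≫ f) ≫ g := by rw [h1]; simp
        _ = scalar r' (S a) ≫ scalar r (S a) := by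
          rw [← h2, reassoc_of% scalar_naturality, h1]
    have e2 : r' ≫ r' = r ≫ r' := by
      rw [← scalarOf_scalar (e b) (r' ≫ r'), ← scalarOf_scalar (e b) (r ≫ r'), scalar_comp,
        scalar_comp]
      congr 1
      calc scalar r' (S b) ≫ scalar r' (S b) = g ≫ (f ≫ g) ≫ f := by rw [h2]; simp
        _ = scalar r (S b) ≫ scalar r' (S b) := by
          rw [← h1, reassoc_of% scalar_naturality, h2]
    have k1 : q r * q r = q r * q r' := by
      rw [← map_mul, ← map_mul]
      exact congrArg q e1
    have k2 : q r' * q r' = q r' * q r := by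
      rw [← map_mul, ← map_mul]
      exact congrArg q e2
    by_cases h0 : q r = 0
    · rw [h0] at k2 ⊢
      simpa [eq_comm] using k2
    · exact mul_left_cancel₀ h0 k1

end Invertible
end TTRing

/-! ### Calculus of ranks. -/

/-- The object `X` is a direct sum of `n` members of the family `S`. -/
def HasRank {C : Type*} [Category* C] [Preadditive C] {I : Type*} (S : I → C) (X : C) (n : ℕ) :
    Prop :=
  ∃ (J : Type) (_ : Fintype J), Fintype.card J = n ∧ Nonempty (TTRing.SumDecomposition S X J)

namespace HasRank

open TTRing

variable {C : Type*} [Category* C] [Preadditive C] {I : Type*} {S : I → C} {X Y : C} {m n : ℕ}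

lemma of_iso (h : HasRank S X n) (e : X ≅ Y) : HasRank S Y n := by
  obtain ⟨J, _, hJ, ⟨D⟩⟩ := h
  exact ⟨J, _, hJ, ⟨D.ofIso e⟩⟩

lemma single (i : I) : HasRank S (S i) 1 := ⟨Unit, _, rfl, ⟨SumDecomposition.single i⟩⟩

lemma map {C' : Type*} [Category* C'] [Preadditive C'] (F : C ⥤ C') [F.Additive] {I' : Type*}
    {S' : I' → C'} (φ : I → I') (e : ∀ i, F.obj (S i) ≅ S' (φ i)) (h : HasRank S X n) :
    HasRank S' (F.obj X) n := by
  obtain ⟨J, _, hJ, ⟨D⟩⟩ := h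
  exact ⟨J, _, hJ, ⟨D.map F φ e⟩⟩

lemma sigma [HasFiniteBiproducts C] {J : Type} [Fintype J] {X : J → C} {n : J → ℕ}
    (h : ∀ j, HasRank S (X j) (n j)) : HasRank S (⨁ X) (∑ j, n j) := by
  choose T _ hT D using h
  exact ⟨Σ j, T j, inferInstance, by simp [hT], ⟨SumDecomposition.sigma fun j => (D j).some⟩⟩

lemma biprod [HasBinaryBiproducts C] (hX : HasRank S X m) (hY : HasRank S Y n) :
    HasRank S (X ⊞ Y) (m + n) := by
  obtain ⟨J, _, rfl, ⟨D⟩⟩ := hX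
  obtain ⟨J', _, rfl, ⟨D'⟩⟩ := hY
  exact ⟨J ⊕ J', inferInstance, by simp, ⟨D.sum D'⟩⟩

lemma tensor [MonoidalCategory C] [MonoidalPreadditive C] [Add I]
    (e : ∀ i i', S i ⊗ S i' ≅ S (i + i')) (hX : HasRank S X m) (hY : HasRank S Y n) :
    HasRank S (X ⊗ Y) (m * n) := by
  obtain ⟨J, _, rfl, ⟨D⟩⟩ := hX
  obtain ⟨J', _, rfl, ⟨D'⟩⟩ := hY
  exact ⟨J × J', inferInstance, by simp, ⟨D.tensor e D'⟩⟩

lemma of_isZero (h : IsZero X) : HasRank S X 0 :=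
  ⟨Empty, inferInstance, rfl, ⟨{
    idx := Empty.elim
    inc j := j.elim
    proj j := j.elim
    inc_proj j := j.elim
    inc_proj_ne {j} := j.elim
    total := h.eq_of_src _ _ }⟩⟩

lemma isZero (h : HasRank S X 0) : IsZero X := by
  obtain ⟨J, _, hJ, ⟨D⟩⟩ := h
  have := Fintype.card_eq_zero_iff.1 hJ
  rw [IsZero.iff_id_eq_zero, ← D.total]
  simp

end HasRank

-- The map `X ⟶ 0` becomes invertible under `F`, hence is invertible.
open ZeroObject in
lemma isZero_of_isZero_map {C D : Type*} [Category* C] [Category* D] [HasZeroMorphisms C]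
    [HasZeroMorphisms D] [HasZeroObject C] (F : C ⥤ D)
    [F.PreservesZeroMorphisms] [F.ReflectsIsomorphisms] {X : C} (h : IsZero (F.obj X)) :
    IsZero X := by
  have : IsIso (F.map (0 : X ⟶ 0)) :=
    ⟨0, h.eq_of_src _ _, (F.map_isZero (isZero_zero C)).eq_of_src _ _⟩
  have := isIso_of_reflects_iso (0 : X ⟶ 0) F
  exact (isZero_zero C).of_iso (asIso (0 : X ⟶ 0))

/-! ### Ranks with respect to suspensions of the unit. -/

namespace TTCategory

section ShiftUnit

variable {K : Type*} [Category* K] [HasShift K ℤ] [MonoidalCategory K]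

variable (K) in
/-- The suspensions of the unit object. -/
abbrev shiftUnit (n : ℤ) : K := (shiftFunctor K n).obj (𝟙_ K)

/-- The zeroth suspension of the unit is the unit. -/
noncomputable def shiftUnitZero : shiftUnit K 0 ≅ 𝟙_ K := (shiftFunctorZero K ℤ).app _

variable [Preadditive K]

lemma hasRank_unit : HasRank (shiftUnit K) (𝟙_ K) 1 :=
  (HasRank.single (S := shiftUnit K) 0).of_iso shiftUnitZero

lemma hasRank_copies [HasZeroObject K] [HasBinaryBiproducts K] (n : ℕ) :
    HasRank (shiftUnit K) (TTRing.copies K n) n := by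
  induction n with
  | zero => exact HasRank.of_isZero (isZero_zero K)
  | succ n ih => exact ih.biprod hasRank_unit

lemma hasRank_shift [∀ n : ℤ, (shiftFunctor K n).Additive] {X : K} {n : ℕ}
    (h : HasRank (shiftUnit K) X n) (i : ℤ) :
    HasRank (shiftUnit K) ((shiftFunctor K i).obj X) n :=
  h.map (shiftFunctor K i) (· + i) fun a => ((shiftFunctorAdd K a i).app _).symm

lemma hasRank_map {L : Type*} [Category* L] [HasShift L ℤ] [MonoidalCategory L] [Preadditive L]
    (F : K ⥤ L) [F.Monoidal] [F.CommShift ℤ] [F.Additive] {X : K} {n : ℕ}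
    (h : HasRank (shiftUnit K) X n) : HasRank (shiftUnit L) (F.obj X) n :=
  h.map F id fun i => (F.commShiftIso i).app _ ≪≫
    (shiftFunctor L i).mapIso (Functor.Monoidal.εIso F).symm

end ShiftUnit

variable {K : Type*} [Category* K] [Preadditive K] [HasZeroObject K] [HasShift K ℤ]
    [∀ n : ℤ, (shiftFunctor K n).Additive] [Pretriangulated K]
    [MonoidalCategory K] [SymmetricCategory K] [TTCategory K]

attribute [local instance] commShift

variable (K) in
lemma monoidalPreadditive : MonoidalPreadditive K := by
  have l (X : K) : ((curriedTensor K).obj X).Additive := by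
    have := exact_left X
    infer_instance
  have r (X : K) : ((curriedTensor K).flip.obj X).Additive := by
    have := exact_right X
    infer_instance
  exact {
    whiskerLeft_zero {X Y Z} := ((curriedTensor K).obj X).map_zero Y Z
    zero_whiskerRight {X Y Z} := ((curriedTensor K).flip.obj X).map_zero Y Z
    whiskerLeft_add {X Y Z} f g := ((curriedTensor K).obj X).map_add
    add_whiskerRight {X Y Z} f g := ((curriedTensor K).flip.obj X).map_add }

variable (K) in
/-- The tensor product of suspensions of the unit. -/
noncomputable def shiftUnitAdd (a b : ℤ) :
    shiftUnit K a ⊗ shiftUnit K b ≅ shiftUnit K (a + b) :=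
  (((curriedTensor K).obj (shiftUnit K a)).commShiftIso b).app (𝟙_ K) ≪≫
    (shiftFunctor K b).mapIso (ρ_ (shiftUnit K a)) ≪≫ ((shiftFunctorAdd K a b).app _).symm

lemma rank_unique {X : K} {m n : ℕ} (h1 : ¬ IsZero (𝟙_ K)) (h : HasRank (shiftUnit K) X m)
    (h' : HasRank (shiftUnit K) X n) : m = n := by
  have := monoidalPreadditive K
  obtain ⟨J, _, rfl, ⟨D⟩⟩ := h
  obtain ⟨J', _, rfl, ⟨D'⟩⟩ := h'
  exact D.card_eq (fun i => ⟨shiftUnit K (-i), ⟨shiftUnitAdd K i (-i) ≪≫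
    eqToIso (by rw [add_neg_cancel]) ≪≫ shiftUnitZero⟩⟩) h1 D'

lemma hasRank_tensor {X Y : K} {m n : ℕ} (hX : HasRank (shiftUnit K) X m)
    (hY : HasRank (shiftUnit K) Y n) : HasRank (shiftUnit K) (X ⊗ Y) (m * n) :=
  have := monoidalPreadditive K
  hX.tensor (shiftUnitAdd K) hY

end TTCategory

/-! ### Ranks along the tower and the theorem. -/

section Conservative

open TTCategory ZeroObject

variable {K : Type*} [Category* K] [Preadditive K] [HasZeroObject K] [HasShift K ℤ]
    [∀ n : ℤ, (shiftFunctor K n).Additive] [Pretriangulated K]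
    [MonoidalCategory K] [SymmetricCategory K] [TTCategory K]
    {L : Type*} [Category* L] [Preadditive L] [HasZeroObject L] [HasShift L ℤ]
    [∀ n : ℤ, (shiftFunctor L n).Additive] [Pretriangulated L]
    [MonoidalCategory L] [SymmetricCategory L] [TTCategory L]

variable (F : K ⥤ L) [F.Braided] [F.CommShift ℤ] [F.IsTriangulated]

/-- The hypothesis `hL` first provides some rank `b` for `F A^(n+1)`; comparing the two ranks of `F
(A^(n) ⊗ A)` then determines `b`. -/
theorem TTRing.SplittingTower.hasRank {A : TTRing K} (h1 : ¬ IsZero (𝟙_ L))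
    (hL : ∀ X : L, ∃ n, HasRank (shiftUnit L) X n) {d : ℕ}
    (hA : HasRank (shiftUnit L) (F.obj A.X) d) (T : SplittingTower A) (n : ℕ) :
    HasRank (shiftUnit L) (F.obj (T.obj n).X) (d.descFactorial n) := by
  have := monoidalPreadditive K
  induction n with
  | zero => exact hasRank_unit.of_iso (Functor.Monoidal.εIso F ≪≫ F.mapIso T.isoZero.symm)
  | succ n ih =>
    obtain ⟨α, β, h⟩ := T.exists_decomposition n
    have := T.isMonHom_map n
    obtain ⟨e⟩ := h.nonempty_iso
    obtain ⟨b, hb⟩ := hL (F.obj (T.obj (n + 1)).X)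
    have hl := (hasRank_tensor ih hA).of_iso (Functor.Monoidal.μIso F _ _ ≪≫ F.mapIso e)
    have hr := ((hasRank_tensor ih (hasRank_map F (hasRank_copies n))).of_iso
      (Functor.Monoidal.μIso F _ _)).biprod hb
    have := preservesBinaryBiproducts_of_preservesBiproducts F
    have key := rank_unique h1 hl (hr.of_iso (F.mapBiprod _ _).symm)
    have hbn : b = d.descFactorial (n + 1) := by
      -- The truncated subtraction is harmless: `key` exhibits `b` as an actual difference.
      rw [Nat.descFactorial_succ, Nat.sub_mul, mul_comm d, mul_comm n, key]
      simp
    exact hbn ▸ hb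

end Conservative

theorem theorem4p2
    {K : Type*} [Category* K] [Preadditive K] [HasZeroObject K] [HasShift K ℤ]
    [∀ n : ℤ, (shiftFunctor K n).Additive] [Pretriangulated K]
    [MonoidalCategory K] [SymmetricCategory K] [TTCategory K]
    {L : Type*} [Category* L] [Preadditive L] [HasZeroObject L] [HasShift L ℤ]
    [∀ n : ℤ, (shiftFunctor L n).Additive] [Pretriangulated L]
    [MonoidalCategory L] [SymmetricCategory L] [TTCategory L]
    (hK : ¬ IsZero (𝟙_ K))
    (F : K ⥤ L) [F.Braided] [F.CommShift ℤ] [F.IsTriangulated] [F.ReflectsIsomorphisms]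
    (hL : ∀ X : L, ∃ (n : ℕ) (s : Fin n → ℤ),
      Nonempty (X ≅ ⨁ fun j : Fin n => (shiftFunctor L (s j)).obj (𝟙_ L)))
    (A : TTRing K) :
    (∃ d : ℕ, A.HasDegree d) ∧
    ∀ (k l : ℤ) (r : ℤ → ℕ),
      Nonempty (F.obj A.X ≅ ⨁ fun i : Finset.Icc k l =>
        (shiftFunctor L (i : ℤ)).obj (⨁ fun _ : Fin (r i) => 𝟙_ L)) →
      A.HasDegree (∑ i ∈ Finset.Icc k l, r i) := by
  have := TTCategory.isIdempotentComplete (K := K)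
  have := TTCategory.monoidalPreadditive K
  have h1 : ¬ IsZero (𝟙_ L) := fun h =>
    hK (isZero_of_isZero_map F (h.of_iso (Functor.Monoidal.εIso F).symm))
  have hL' (X : L) : ∃ n, HasRank (TTCategory.shiftUnit L) X n := by
    obtain ⟨n, s, ⟨e⟩⟩ := hL X
    exact ⟨_, (HasRank.sigma fun j => HasRank.single (s j)).of_iso e.symm⟩
  have hdeg {d : ℕ} (hd : HasRank (TTCategory.shiftUnit L) (F.obj A.X) d) : A.HasDegree d := {
    exists_tower := TTRing.exists_splittingTower A
    -- A zero object has rank `0`, whereas the rank here is `d!`.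
    not_isZero T h := by
      have := TTCategory.rank_unique h1 (T.hasRank F h1 hL' hd d) (HasRank.of_isZero (F.map_isZero h))
      rw [Nat.descFactorial_self] at this
      exact d.factorial_ne_zero this
    isZero T := by
      have := T.hasRank F h1 hL' hd (d + 1)
      rw [Nat.descFactorial_of_lt d.lt_succ_self] at this
      exact isZero_of_isZero_map F this.isZero }
  -- Any presentation of `F A` as a sum of suspensions gives a degree; grouping equal suspensions
  -- gives the stated sum.
  refine ⟨(hL' (F.obj A.X)).imp fun d => hdeg, fun k l r ⟨e⟩ => hdeg ?_⟩
  rw [← Finset.sum_coe_sort]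
  refine (HasRank.sigma fun i => ?_).of_iso e.symm
  refine TTCategory.hasRank_shift ?_ _
  simpa using HasRank.sigma (J := Fin (r i)) fun _ => TTCategory.hasRank_unit (K := L)
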